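/- Let $k$ be a field, let $\Lambda$ be a finite dimensional $k$-algebra, and let $\hat{\mathcal C}$ be the category of complete local commutative Noetherian $k$-algebras with residue field $k$, whose morphisms are the continuous $k$-algebra homomorphisms inducing the identity on $k$. Write $R\Lambda = R\otimes_k\Lambda$. For a finitely generated left $\Lambda$-module $V$: * A *lift* of $V$ over $R\in\hat{\mathcal C}$ is a pair $(M,\phi)$ of a finitely generated left $R\Lambda$-module $M$ that is free over $R$ and a $\Lambda$-isomorphism $\phi: k\otimes_R M\to V$. Lifts $(M,\phi)$ and $(M',\phi')$ are *isomorphic* if there is an $R\Lambda$-isomorphism $f:M\to M'$ with $\phi'\circ(k\otimes_R f)=\phi$. The *deformation functor* $\hat F_V:\hat{\mathcal C}\to\mathrm{Sets}$ sends $R$ to the set of isomorphism classes $[M,\phi]$ of lifts of $V$ over $R$, and $\alpha:R\to R'$ to $[M,\phi]\mapsto[R'\otimes_{R,\alpha}M,\phi_\alpha]$, where $\phi_\alpha$ is the composite $k\otimes_{R'}(R'\otimes_{R,\alpha}M)\cong k\otimes_R M\xrightarrow{\phi}V$. The *weak deformation functor* $\hat F_V^w$ sends $R$ to the set of $R\Lambda$-isomorphism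 classes $[M]$ of the modules underlying lifts $(M,\phi)$ of $V$ over $R$, and $\alpha$ to $[M]\mapsto[R'\otimes_{R,\alpha}M]$. * $R_0\in\hat{\mathcal C}$ together with $u\in\hat F_V(R_0)$ is a *versal* deformation ring of $V$ if for every $R\in\hat{\mathcal C}$ and $d\in\hat F_V(R)$ there is a morphism $\psi:R_0\to R$ with $\hat F_V(\psi)(u)=d$, and $\psi$ is unique when $R=k[\epsilon]$ with $\epsilon^2=0$. It is *universal* if $\psi$ is unique for all $R$ and $d$. The versal deformation ring is denoted $R(\Lambda,V)$. * The *stable endomorphism ring* $\underline{\mathrm{End}}_\Lambda(V)$ is the quotient of $\mathrm{End}_\Lambda(V)$ by the ideal of endomorphisms factoring through a projective $\Lambda$-module. The *syzygy* $\Omega V$ is the kernel of a projective cover $P\to V$. * $V$ is *Gorenstein-projective* if it is the cokernel of a differential of an acyclic complex $P^\bullet$ of projective left $\Lambda$-modules such that $\mathrm{Hom}_\Lambda(P^\bullet,\Lambda)$ is also acyclic. **Theorem.** Let $V$ be a finitely generated Gorenstein-projective left $\Lambda$-module such that $\underline{\mathrm{End}}_\Lambda(V)\cong k$ as $k$-algebras.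 Then: 1. The map $[M,\phi]\mapsto[M]$ is a natural isomorphism $\hat F_V\cong\hat F_V^w$. 2. $V$ has a universal deformation ring, and every versal deformation ring of $V$ is universal. Moreover $\underline{\mathrm{End}}_\Lambda(\Omega V)\cong k$ as $k$-algebras, $\Omega V$ has a universal deformation ring, and every versal deformation ring of $\Omega V$ is universal. -/

import Mathlib

open CategoryTheory
open scoped TensorProduct

universe u

namespace ModuleDeformation

/-! ### Modules over finite dimensional algebras -/

section Algebras

variable (k Λ V : Type u) [Field k] [Ring Λ] [Algebra k Λ] [AddCommGroup V] [Module Λ V]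

/-- `V` is Gorenstein-projective: it is the cokernel of a differential of an acyclic complex of
(not necessarily finitely generated) projective left `Λ`-modules which stays acyclic under
`Hom_Λ(-, Λ)`. -/
def IsGorensteinProjective : Prop :=
  ∃ (P : ℤ → Type u) (_ : ∀ n, AddCommGroup (P n)) (_ : ∀ n, Module Λ (P n))
    (d : ∀ n : ℤ, P n →ₗ[Λ] P (n + 1)),
    (∀ n, Module.Projective Λ (P n)) ∧
    (∀ n, Function.Exact (d n) (d (n + 1))) ∧
    (∀ n, Function.Exact
      (fun g : P (n + 1 + 1) →ₗ[Λ] Λ => g ∘ₗ d (n + 1))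
      (fun g : P (n + 1) →ₗ[Λ] Λ => g ∘ₗ d n)) ∧
    Nonempty ((P (0 + 1) ⧸ LinearMap.range (d 0)) ≃ₗ[Λ] V)

/-- `f` factors through a projective `Λ`-module. -/
def FactorsThroughProjective {Λ V : Type u} [Ring Λ] [AddCommGroup V] [Module Λ V]
    (f : Module.End Λ V) : Prop :=
  ∃ (P : Type u) (_ : AddCommGroup P) (_ : Module Λ P) (i : V →ₗ[Λ] P) (p : P →ₗ[Λ] V),
    Module.Projective Λ P ∧ f = p ∘ₗ i

/-- The two-sided ideal of `End_Λ(V)` of endomorphisms that factor through a projective module. -/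
def projectiveIdeal : TwoSidedIdeal (Module.End Λ V) :=
  TwoSidedIdeal.mk' {f | FactorsThroughProjective f}
    ⟨PUnit, inferInstance, inferInstance, 0, 0, inferInstance, by simp⟩
    (by
      rintro f g ⟨P, _, _, i, p, hP, rfl⟩ ⟨Q, _, _, j, q, hQ, rfl⟩
      exact ⟨P × Q, inferInstance, inferInstance, i.prod j, p.coprod q, inferInstance,
        by ext; simp⟩)
    (by
      rintro f ⟨P, _, _, i, p, hP, rfl⟩
      exact ⟨P, inferInstance, inferInstance, i, -p, hP, by ext; simp⟩)
    (by
      rintro f g ⟨P, _, _, i, p, hP, rfl⟩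
      exact ⟨P, inferInstance, inferInstance, i, f ∘ₗ p, hP, by ext; simp⟩)
    (by
      rintro f g ⟨P, _, _, i, p, hP, rfl⟩
      exact ⟨P, inferInstance, inferInstance, i ∘ₗ g, p, hP, by ext; simp⟩)

/-- The stable endomorphism ring of `V`. -/
abbrev StableEnd : Type u := (projectiveIdeal Λ V).ringCon.Quotient

variable {Λ V}

/-- `p : P → V` is a projective cover of the finitely generated module `V`: the module `P` is
finitely generated projective, `p` is surjective and its kernel is superfluous in `P`. -/
structure IsProjectiveCover {P : Type u} [AddCommGroup P] [Module Λ P] (p : P →ₗ[Λ] V) :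
    Prop where
  finite : Module.Finite Λ P
  projective : Module.Projective Λ P
  surjective : Function.Surjective p
  superfluous : ∀ N : Submodule Λ P, LinearMap.ker p ⊔ N = ⊤ → N = ⊤

end Algebras

/-- Finitely generated modules over a finite dimensional algebra have projective covers. -/
theorem exists_isProjectiveCover (k : Type u) {Λ V : Type u} [Field k] [Ring Λ] [Algebra k Λ]
    [Module.Finite k Λ] [AddCommGroup V] [Module Λ V] [Module.Finite Λ V] :
    ∃ (P : Type u) (_ : AddCommGroup P) (_ : Module Λ P) (p : P →ₗ[Λ] V),
      IsProjectiveCover p := by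
  have hΛ : IsArtinianRing Λ := IsArtinianRing.of_finite k Λ
  -- choose a projective presentation of minimal length
  let S : Set ℕ∞ := {l | ∃ (P : Type u) (_ : AddCommGroup P) (_ : Module Λ P) (p : P →ₗ[Λ] V),
    Module.Finite Λ P ∧ Module.Projective Λ P ∧ Function.Surjective p ∧ Module.length Λ P = l}
  have hS : S.Nonempty := by
    obtain ⟨n, f, hf⟩ := Module.Finite.exists_fin' Λ V
    exact ⟨_, Fin n → Λ, inferInstance, inferInstance, f, inferInstance, inferInstance, hf, rfl⟩
  obtain ⟨P, _, _, p, hfin, hproj, hsurj, hlen⟩ := csInf_mem hS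
  refine ⟨P, inferInstance, inferInstance, p, hfin, hproj, hsurj, fun N hN => ?_⟩
  have hpN : Function.Surjective (p ∘ₗ N.subtype) := by
    intro v
    obtain ⟨x, rfl⟩ := hsurj v
    obtain ⟨y, hy, z, hz, rfl⟩ := Submodule.mem_sup.1 (hN ▸ Submodule.mem_top : x ∈ _)
    exact ⟨⟨z, hz⟩, by simp [LinearMap.mem_ker.1 hy]⟩
  obtain ⟨e', he'⟩ := Module.projective_lifting_property (p ∘ₗ N.subtype) p hpN
  let e : Module.End Λ P := N.subtype ∘ₗ e'
  have hpe : p ∘ₗ e = p := he'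
  have hpen : ∀ n : ℕ, p ∘ₗ (e ^ n) = p := by
    intro n
    induction n with
    | zero => rfl
    | succ n ih => rw [pow_succ, Module.End.mul_eq_comp, ← LinearMap.comp_assoc, ih, hpe]
  obtain ⟨n, hn, hn1⟩ :=
    ((LinearMap.eventually_isCompl_ker_pow_range_pow e).and
      (Filter.eventually_ge_atTop 1)).exists
  obtain ⟨m, rfl⟩ := Nat.exists_eq_add_of_le' hn1
  have hQ : Module.Projective Λ (LinearMap.range (e ^ (m + 1))) := by
    refine Module.Projective.of_split (LinearMap.range (e ^ (m + 1))).subtype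
      (Submodule.projectionOnto _ _ hn.symm) ?_
    exact LinearMap.ext fun x => Submodule.projectionOnto_apply_left hn.symm x
  have htop : LinearMap.range (e ^ (m + 1)) = ⊤ := by
    by_contra hne
    have hlt := Submodule.length_lt hne
    rw [hlen] at hlt
    refine not_lt_of_ge (csInf_le' ?_) hlt
    refine ⟨LinearMap.range (e ^ (m + 1)), inferInstance, inferInstance,
      p ∘ₗ (LinearMap.range (e ^ (m + 1))).subtype, inferInstance, hQ, ?_, rfl⟩
    intro v
    obtain ⟨x, rfl⟩ := hsurj v
    exact ⟨⟨(e ^ (m + 1)) x, x, rfl⟩, LinearMap.congr_fun (hpen (m + 1)) x⟩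
  rw [eq_top_iff, ← htop]
  rintro _ ⟨x, rfl⟩
  rw [pow_succ', Module.End.mul_apply]
  exact (e' _).2

section BaseChange

variable {k Λ : Type u} [Field k] [Ring Λ] [Algebra k Λ]
variable {R S T : Type u} [CommRing R] [Algebra k R] [CommRing S] [Algebra k S]
  [CommRing T] [Algebra k T]

/-- The base change `S ⊗_{R,α} M` of an `R`-module along `α : R → S`. -/
def BaseChange (α : R →ₐ[k] S) (M : Type u) [AddCommGroup M] [Module R M] : Type u :=
  letI := α.toRingHom.toAlgebra
  S ⊗[R] M

namespace BaseChange

variable (α : R →ₐ[k] S) (M : Type u) [AddCommGroup M] [Module R M]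

instance : AddCommGroup (BaseChange α M) :=
  letI := α.toRingHom.toAlgebra
  (inferInstance : AddCommGroup (S ⊗[R] M))

instance : Module S (BaseChange α M) :=
  letI := α.toRingHom.toAlgebra
  (inferInstance : Module S (S ⊗[R] M))

variable {M} in
/-- The pure tensor `s ⊗ m`. -/
def tmul (s : S) (m : M) : BaseChange α M :=
  letI := α.toRingHom.toAlgebra
  (s ⊗ₜ[R] m : S ⊗[R] M)

variable {α M}

@[elab_as_elim]
theorem induction {motive : BaseChange α M → Prop} (x : BaseChange α M)
    (tmul : ∀ s m, motive (tmul α s m)) (add : ∀ x y, motive x → motive y → motive (x + y)) :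
    motive x :=
  letI := α.toRingHom.toAlgebra
  TensorProduct.induction_on x
    (by
      have h := tmul 0 0
      rwa [show BaseChange.tmul α (0 : S) (0 : M) = 0 from TensorProduct.zero_tmul _ _] at h)
    tmul add

theorem tmul_add (s : S) (m m' : M) : tmul α s (m + m') = tmul α s m + tmul α s m' :=
  letI := α.toRingHom.toAlgebra
  TensorProduct.tmul_add s m m'

theorem smul_tmul (s s' : S) (m : M) : s • tmul α s' m = tmul α (s * s') m := rfl

theorem tmul_smul (s : S) (r : R) (m : M) : tmul α s (r • m) = tmul α (α r * s) m :=
  letI := α.toRingHom.toAlgebra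
  (TensorProduct.tmul_smul r s m).trans (TensorProduct.smul_tmul' r s m)

/-- An `S`-linear map out of `S ⊗_{R,α} M` is a semilinear map out of `M`. -/
def lift {N : Type u} [AddCommGroup N] [Module S N] (f : M →ₛₗ[α.toRingHom] N) :
    BaseChange α M →ₗ[S] N :=
  letI := α.toRingHom.toAlgebra
  letI : Module R N := Module.compHom N α.toRingHom
  haveI : IsScalarTower R S N := ⟨fun r s n => mul_smul (α r) s n⟩
  TensorProduct.AlgebraTensorModule.lift
    ((LinearMap.ringLmapEquivSelf S ℕ (M →ₗ[R] N)).symm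
      { toFun := f, map_add' := f.map_add, map_smul' := f.map_smulₛₗ })

theorem lift_tmul {N : Type u} [AddCommGroup N] [Module S N] (f : M →ₛₗ[α.toRingHom] N)
    (s : S) (m : M) : lift f (tmul α s m) = s • f m := rfl


theorem tmul_eq_smul (s : S) (m : M) : tmul α s m = s • tmul α 1 m := by
  rw [smul_tmul, mul_one]

/-- An `S`-linear map which commutes with the action of `Λ` is `S ⊗ Λ`-linear. -/
def mkLinear {X Y : Type u} [AddCommGroup X] [AddCommGroup Y] [Module S X] [Module S Y]
    [Module (S ⊗[k] Λ) X] [Module (S ⊗[k] Λ) Y] [IsScalarTower S (S ⊗[k] Λ) X]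
    [IsScalarTower S (S ⊗[k] Λ) Y] (f : X →ₗ[S] Y)
    (hf : ∀ (l : Λ) (x : X), f ((1 ⊗ₜ[k] l : S ⊗[k] Λ) • x) = (1 ⊗ₜ[k] l : S ⊗[k] Λ) • f x) :
    X →ₗ[S ⊗[k] Λ] Y where
  toFun := f
  map_add' := f.map_add
  map_smul' a x := by
    induction a with
    | zero => simp
    | add a b ha hb => simp_all [add_smul]
    | tmul s l =>
      have h : (s ⊗ₜ[k] l : S ⊗[k] Λ) = s • (1 ⊗ₜ[k] l : S ⊗[k] Λ) := by
        rw [TensorProduct.smul_tmul', smul_eq_mul, mul_one]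
      simp [h, smul_assoc, hf]

section Action

variable (α M)
variable [Module (R ⊗[k] Λ) M] [IsScalarTower R (R ⊗[k] Λ) M]

theorem one_tmul_smul_comm (l : Λ) (r : R) (m : M) :
    (1 ⊗ₜ[k] l : R ⊗[k] Λ) • r • m = r • (1 ⊗ₜ[k] l : R ⊗[k] Λ) • m := by
  have h (r : R) (m : M) : r • m = (r ⊗ₜ[k] (1 : Λ) : R ⊗[k] Λ) • m := by
    have h1 : (r ⊗ₜ[k] (1 : Λ) : R ⊗[k] Λ) = r • (1 : R ⊗[k] Λ) := by
      rw [Algebra.TensorProduct.one_def, TensorProduct.smul_tmul', smul_eq_mul, mul_one]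
    rw [h1, smul_assoc, one_smul]
  rw [h, h, ← mul_smul, ← mul_smul]
  simp

/-- The action of `l ∈ Λ` on `S ⊗_{R,α} M`, namely `s ⊗ m ↦ s ⊗ lm`. -/
def act (l : Λ) : Module.End S (BaseChange α M) :=
  lift
    { toFun := fun m => tmul α 1 ((1 ⊗ₜ[k] l : R ⊗[k] Λ) • m)
      map_add' := fun m m' => by rw [smul_add, tmul_add]
      map_smul' := fun r m => by
        rw [one_tmul_smul_comm, tmul_smul, smul_tmul]; rfl }

theorem act_tmul (l : Λ) (s : S) (m : M) :
    act α M l (tmul α s m) = tmul α s ((1 ⊗ₜ[k] l : R ⊗[k] Λ) • m) := by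
  rw [act, lift_tmul]
  exact (tmul_eq_smul _ _).symm

theorem end_ext {N : Type u} [AddCommGroup N] [Module S N] {f g : BaseChange α M →ₗ[S] N}
    (h : ∀ m, f (tmul α 1 m) = g (tmul α 1 m)) : f = g := by
  ext x
  induction x using BaseChange.induction with
  | tmul s m => rw [tmul_eq_smul, map_smul, map_smul, h]
  | add x y hx hy => rw [map_add, map_add, hx, hy]

/-- The action of `S ⊗ Λ` on `S ⊗_{R,α} M`. -/
def toEnd : S ⊗[k] Λ →+* Module.End S (BaseChange α M) :=
  letI : Module k (BaseChange α M) := Module.compHom _ (algebraMap k S)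
  haveI : IsScalarTower k S (BaseChange α M) :=
    ⟨fun c s x => by rw [Algebra.smul_def, mul_smul]; rfl⟩
  haveI : SMulCommClass S k (BaseChange α M) := IsScalarTower.to_smulCommClass'
  haveI : SMulCommClass k S (BaseChange α M) := IsScalarTower.to_smulCommClass
  (Algebra.TensorProduct.lift (Algebra.ofId S (Module.End S (BaseChange α M)))
    (AlgHom.mk (R := k) (A := Λ) (B := Module.End S (BaseChange α M))
      { toFun := act α M
        map_one' := end_ext _ _ fun m => by
          rw [act_tmul, ← Algebra.TensorProduct.one_def, one_smul]; rfl
        map_mul' := fun l l' => end_ext _ _ fun m => by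
          rw [Module.End.mul_apply, act_tmul, act_tmul, act_tmul, ← mul_smul]
          simp
        map_zero' := end_ext _ _ fun m => by
          rw [act_tmul, TensorProduct.tmul_zero, zero_smul, ← zero_smul R (0 : M), tmul_smul,
            map_zero, zero_mul, ← zero_mul (0 : S), ← smul_tmul, zero_smul]
          rfl
        map_add' := fun l l' => end_ext _ _ fun m => by
          rw [LinearMap.add_apply, act_tmul, act_tmul, act_tmul, TensorProduct.tmul_add,
            add_smul, tmul_add] }
      fun c => end_ext _ _ fun m => by
        change act α M (algebraMap k Λ c) _ = algebraMap k S c • tmul α 1 m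
        rw [act_tmul, Algebra.algebraMap_eq_smul_one, ← TensorProduct.smul_tmul,
          Algebra.smul_def, mul_one, ← mul_one (algebraMap k R c), ← smul_eq_mul,
          ← TensorProduct.smul_tmul', smul_assoc, ← Algebra.TensorProduct.one_def, one_smul,
          tmul_smul, α.commutes, smul_tmul])
    (fun s f => Algebra.commutes s _)).toRingHom

theorem toEnd_tmul (s : S) (l : Λ) : toEnd α M (s ⊗ₜ[k] l) = s • act α M l := by
  let _ : Module k (BaseChange α M) := Module.compHom _ (algebraMap k S)
  have _ : IsScalarTower k S (BaseChange α M) :=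
    ⟨fun c s x => by rw [Algebra.smul_def, mul_smul]; rfl⟩
  have _ : SMulCommClass S k (BaseChange α M) := IsScalarTower.to_smulCommClass'
  have _ : SMulCommClass k S (BaseChange α M) := IsScalarTower.to_smulCommClass
  refine (Algebra.TensorProduct.lift_tmul _ _ _ _ _).trans ?_
  rw [Algebra.smul_def]
  rfl

/-- `S ⊗_{R,α} M` is an `S ⊗ Λ`-module, with `(s ⊗ l)(s' ⊗ m) = ss' ⊗ lm`. -/
instance : Module (S ⊗[k] Λ) (BaseChange α M) := Module.compHom _ (toEnd α M)

theorem smul_def (a : S ⊗[k] Λ) (x : BaseChange α M) : a • x = toEnd α M a x := rfl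

variable {M} in
theorem tmul_smul_tmul (s s' : S) (l : Λ) (m : M) :
    (s ⊗ₜ[k] l : S ⊗[k] Λ) • tmul α s' m = tmul α (s * s') ((1 ⊗ₜ[k] l : R ⊗[k] Λ) • m) := by
  rw [smul_def, toEnd_tmul, LinearMap.smul_apply, act_tmul, smul_tmul]

instance : IsScalarTower S (S ⊗[k] Λ) (BaseChange α M) :=
  ⟨fun s a x => by
    induction a with
    | zero => simp
    | add a b ha hb => simp only [smul_add, add_smul, ha, hb]
    | tmul s' l =>
      rw [TensorProduct.smul_tmul', smul_eq_mul, smul_def, smul_def, toEnd_tmul, toEnd_tmul,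
        mul_smul, LinearMap.smul_apply]⟩

instance [Module.Free R M] : Module.Free S (BaseChange α M) :=
  letI := α.toRingHom.toAlgebra
  (inferInstance : Module.Free S (S ⊗[R] M))

variable {M} in
theorem map_smul_tmul_one (a : R ⊗[k] Λ) (m : M) :
    Algebra.TensorProduct.map α (AlgHom.id k Λ) a • tmul α 1 m = tmul α 1 (a • m) := by
  induction a with
  | zero => rw [map_zero, zero_smul, zero_smul, ← zero_smul R (0 : M), tmul_smul,
            map_zero, zero_mul, ← zero_mul (0 : S), ← smul_tmul, zero_smul]
  | add a b ha hb => simp only [add_smul, map_add, tmul_add, ha, hb]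
  | tmul r l =>
    rw [Algebra.TensorProduct.map_tmul, tmul_smul_tmul, AlgHom.id_apply,
      ← tmul_smul, ← smul_assoc, TensorProduct.smul_tmul', smul_eq_mul, mul_one]

instance [Module.Finite (R ⊗[k] Λ) M] : Module.Finite (S ⊗[k] Λ) (BaseChange α M) := by
  obtain ⟨s, hs⟩ := Module.Finite.fg_top (R := R ⊗[k] Λ) (M := M)
  classical
  refine ⟨⟨s.image (tmul α 1), ?_⟩⟩
  rw [eq_top_iff]
  rintro x -
  induction x using BaseChange.induction with
  | add x y hx hy => exact add_mem hx hy
  | tmul t m =>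
    rw [tmul_eq_smul, ← one_smul (S ⊗[k] Λ) (tmul α 1 m), ← smul_assoc]
    refine Submodule.smul_mem _ _ ?_
    have hm : m ∈ Submodule.span (R ⊗[k] Λ) (s : Set M) := hs ▸ Submodule.mem_top
    induction hm using Submodule.span_induction with
    | mem m hm => exact Submodule.subset_span (by simpa using ⟨m, hm, rfl⟩)
    | zero =>
      rw [← zero_smul (R ⊗[k] Λ) (0 : M), ← map_smul_tmul_one, map_zero, zero_smul]
      exact zero_mem _
    | add m m' _ _ h h' => rw [tmul_add]; exact add_mem h h'
    | smul a m _ h => rw [← map_smul_tmul_one]; exact Submodule.smul_mem _ _ h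

end Action

section Functoriality

variable {M' : Type u} [AddCommGroup M'] [Module R M']
variable [Module (R ⊗[k] Λ) M] [IsScalarTower R (R ⊗[k] Λ) M]
variable [Module (R ⊗[k] Λ) M'] [IsScalarTower R (R ⊗[k] Λ) M']

variable (α) in
/-- The map `S ⊗_{R,α} f`. -/
def map (f : M →ₗ[R ⊗[k] Λ] M') : BaseChange α M →ₗ[S ⊗[k] Λ] BaseChange α M' :=
  mkLinear
    (lift
      { toFun := fun m => tmul α 1 (f m)
        map_add' := fun m m' => by rw [map_add, tmul_add]
        map_smul' := fun r m => by
          rw [LinearMap.map_smul_of_tower, tmul_smul, smul_tmul]; rfl })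
    (fun l x => by
      induction x using BaseChange.induction with
      | add x y hx hy => rw [smul_add, map_add, hx, hy, map_add, smul_add]
      | tmul s m =>
        rw [tmul_smul_tmul, lift_tmul, lift_tmul, one_mul]
        change s • tmul α 1 (f _) = _ • s • tmul α 1 (f m)
        rw [map_smul, smul_tmul, smul_tmul, tmul_smul_tmul, one_mul])

theorem map_tmul (f : M →ₗ[R ⊗[k] Λ] M') (s : S) (m : M) :
    map α f (tmul α s m) = tmul α s (f m) := (tmul_eq_smul _ _).symm

variable (α) in
/-- The isomorphism `S ⊗_{R,α} e`. -/
def congr (e : M ≃ₗ[R ⊗[k] Λ] M') : BaseChange α M ≃ₗ[S ⊗[k] Λ] BaseChange α M' :=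
  { map α e.toLinearMap with
    invFun := map α e.symm.toLinearMap
    left_inv := fun x => by
      change map α _ (map α _ x) = x
      induction x using BaseChange.induction with
      | add x y hx hy => rw [map_add, map_add, hx, hy]
      | tmul s m => simp [map_tmul]
    right_inv := fun x => by
      change map α _ (map α _ x) = x
      induction x using BaseChange.induction with
      | add x y hx hy => rw [map_add, map_add, hx, hy]
      | tmul s m => simp [map_tmul] }

theorem congr_tmul (e : M ≃ₗ[R ⊗[k] Λ] M') (s : S) (m : M) :
    congr α e (tmul α s m) = tmul α s (e m) := map_tmul _ _ _

variable (M) in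
/-- The isomorphism `R ⊗_{R,id} M ≅ M`. -/
def idEquiv (ι : R →ₐ[k] R) (hι : ι = AlgHom.id k R) : BaseChange ι M ≃ₗ[R ⊗[k] Λ] M :=
  { mkLinear (Λ := Λ) (X := BaseChange ι M) (Y := M)
      (lift
        { toFun := fun m => m
          map_add' := fun m m' => rfl
          map_smul' := fun r m => by subst hι; rfl })
      (fun l x => by
        induction x using BaseChange.induction with
        | add x y hx hy => rw [smul_add, map_add, hx, hy, map_add, smul_add]
        | tmul s m =>
          rw [tmul_smul_tmul, lift_tmul, lift_tmul, one_mul]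
          exact (one_tmul_smul_comm _ _ _ _).symm) with
    invFun := fun m => tmul ι 1 m
    left_inv := fun x => by
      change tmul ι 1 (lift (α := ι) _ x) = x
      induction x using BaseChange.induction with
      | add x y hx hy => rw [map_add, tmul_add, hx, hy]
      | tmul s m =>
        rw [lift_tmul]
        change tmul ι 1 (s • m) = _
        rw [tmul_smul, mul_one, hι]; rfl
    right_inv := fun m => one_smul R m }

theorem idEquiv_tmul (ι : R →ₐ[k] R) (hι : ι = AlgHom.id k R) (s : R) (m : M) :
    idEquiv (Λ := Λ) M ι hι (tmul ι s m) = s • m := rfl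

/-- Semilinear version of `lift`. -/
def liftComp (β : S →ₐ[k] T) (γ : R →ₐ[k] T) (h : γ = β.comp α)
    {N : Type u} [AddCommGroup N] [Module T N] (f : M →ₛₗ[γ.toRingHom] N) :
    BaseChange α M →ₛₗ[β.toRingHom] N :=
  letI : Module S N := Module.compHom N β.toRingHom
  { toFun := lift (α := α) (M := M) (N := N)
      { toFun := f, map_add' := f.map_add, map_smul' := fun r m => by
          subst h; exact f.map_smulₛₗ r m }
    map_add' := fun x y => map_add _ x y
    map_smul' := fun s x => map_smul _ s x }

theorem liftComp_tmul (β : S →ₐ[k] T) (γ : R →ₐ[k] T) (h : γ = β.comp α)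
    {N : Type u} [AddCommGroup N] [Module T N] (f : M →ₛₗ[γ.toRingHom] N) (s : S) (m : M) :
    liftComp β γ h f (tmul α s m) = β s • f m := rfl

variable (M) in
/-- The isomorphism `T ⊗_{S,β} (S ⊗_{R,α} M) ≅ T ⊗_{R,γ} M` for `γ = β ∘ α`. -/
def compEquiv (β : S →ₐ[k] T) (γ : R →ₐ[k] T) (h : γ = β.comp α) :
    BaseChange β (BaseChange α M) ≃ₗ[T ⊗[k] Λ] BaseChange γ M :=
  let F : M →ₛₗ[γ.toRingHom] BaseChange γ M :=
    { toFun := tmul γ 1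
      map_add' := tmul_add 1
      map_smul' := fun r m => by rw [tmul_smul, smul_tmul]; rfl }
  let G : M →ₛₗ[γ.toRingHom] BaseChange β (BaseChange α M) :=
    { toFun := fun m => tmul β 1 (tmul α 1 m)
      map_add' := fun m m' => by rw [tmul_add, tmul_add]
      map_smul' := fun r m => by
        subst h
        rw [tmul_smul, ← smul_tmul, tmul_smul, ← smul_tmul]; rfl }
  have hF (t : T) (s : S) (m : M) :
      lift (liftComp β γ h F) (tmul β t (tmul α s m)) = tmul γ (t * β s) m := by
    rw [lift_tmul, liftComp_tmul]
    change t • β s • tmul γ 1 m = _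
    rw [smul_tmul, smul_tmul, mul_one]
  have hG (t : T) (m : M) : lift G (tmul γ t m) = tmul β t (tmul α 1 m) := by
    rw [lift_tmul]
    change t • tmul β 1 (tmul α 1 m) = _
    rw [smul_tmul, mul_one]
  { mkLinear (Λ := Λ) (lift (liftComp β γ h F)) (fun l x => by
      induction x using BaseChange.induction with
      | add x y hx hy => rw [smul_add, map_add, hx, hy, map_add, smul_add]
      | tmul t y =>
        induction y using BaseChange.induction with
        | add x y hx hy => rw [tmul_add, smul_add, map_add, hx, hy, map_add, smul_add]
        | tmul s m => rw [tmul_smul_tmul, tmul_smul_tmul, hF, hF, tmul_smul_tmul, one_mul,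
            one_mul, one_mul]) with
    invFun := lift G
    left_inv := fun x => by
      change lift G (lift (liftComp β γ h F) x) = x
      induction x using BaseChange.induction with
      | add x y hx hy => rw [map_add, map_add, hx, hy]
      | tmul t y =>
        induction y using BaseChange.induction with
        | add x y hx hy => rw [tmul_add, map_add, map_add, hx, hy]
        | tmul s m =>
          rw [hF, hG, mul_comm, ← tmul_smul, smul_tmul, mul_one]
    right_inv := fun x => by
      change lift (liftComp β γ h F) (lift G x) = x
      induction x using BaseChange.induction with
      | add x y hx hy => rw [map_add, map_add, hx, hy]
      | tmul t m => rw [hG, hF, map_one, mul_one] }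

theorem compEquiv_tmul (β : S →ₐ[k] T) (γ : R →ₐ[k] T) (h : γ = β.comp α)
    (t : T) (s : S) (m : M) :
    compEquiv (Λ := Λ) M β γ h (tmul β t (tmul α s m)) = tmul γ (t * β s) m := by
  change t • β s • tmul γ 1 m = _
  rw [smul_tmul, smul_tmul, mul_one]

end Functoriality

end BaseChange
end BaseChange

/-! ### The category of complete local Noetherian `k`-algebras with residue field `k` -/

/-- Complete local commutative Noetherian `k`-algebras with residue field `k`. -/
structure CHat (k : Type u) [Field k] where
  /-- The underlying ring. -/
  carrier : Type u
  [commRing : CommRing carrier]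
  [algebra : Algebra k carrier]
  [isLocalRing : IsLocalRing carrier]
  [isNoetherianRing : IsNoetherianRing carrier]
  [isAdicComplete : IsAdicComplete (IsLocalRing.maximalIdeal carrier) carrier]
  bijective_residue :
    Function.Bijective (algebraMap k (IsLocalRing.ResidueField carrier))

namespace CHat

variable {k : Type u} [Field k]

instance : CoeSort (CHat k) (Type u) := ⟨CHat.carrier⟩

attribute [instance] commRing algebra isLocalRing isNoetherianRing isAdicComplete

/-- The natural surjection `R → k`: reduction modulo the maximal ideal, with the residue field
identified with `k` by means of the `k`-algebra structure of `R`. -/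
noncomputable def residue (R : CHat k) : R →ₐ[k] k :=
  (AlgEquiv.ofBijective (Algebra.ofId k (IsLocalRing.ResidueField R))
    R.bijective_residue).symm.toAlgHom.comp
      (IsScalarTower.toAlgHom k R (IsLocalRing.ResidueField R))

theorem residue_eq_zero_iff (R : CHat k) (r : R) :
    R.residue r = 0 ↔ r ∈ IsLocalRing.maximalIdeal R := by
  rw [← IsLocalRing.residue_eq_zero_iff]
  exact EmbeddingLike.map_eq_zero_iff
    (f := (AlgEquiv.ofBijective (Algebra.ofId k (IsLocalRing.ResidueField R))
      R.bijective_residue).symm)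

/-- Morphisms are the `k`-algebra homomorphisms which induce the identity on residue fields `k`.
They map the maximal ideal into the maximal ideal, hence are continuous for the adic topologies. -/
@[ext]
structure Hom (R S : CHat k) where
  /-- The underlying algebra homomorphism. -/
  toAlgHom : R →ₐ[k] S
  residue_comp : S.residue.comp toAlgHom = R.residue

instance : Category (CHat k) where
  Hom := Hom
  id R := ⟨AlgHom.id k R, rfl⟩
  comp f g := ⟨g.toAlgHom.comp f.toAlgHom, by
    rw [← AlgHom.comp_assoc, g.residue_comp, f.residue_comp]⟩

theorem Hom.map_pow_le {R S : CHat k} (f : R ⟶ S) (n : ℕ) :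
    (IsLocalRing.maximalIdeal R ^ n).map f.toAlgHom ≤ IsLocalRing.maximalIdeal S ^ n := by
  rw [Ideal.map_pow]
  refine Ideal.pow_right_mono (Ideal.map_le_iff_le_comap.2 fun r hr => ?_) n
  rw [Ideal.mem_comap, ← residue_eq_zero_iff]
  rw [← residue_eq_zero_iff, ← f.residue_comp] at hr
  exact hr

/-- The ring of dual numbers `k[ε]`, `ε² = 0`, as an object of the category. -/
noncomputable def dualNumber (k : Type u) [Field k] : CHat k :=
  have hmax (x : DualNumber k) :
      x ∈ IsLocalRing.maximalIdeal (DualNumber k) ↔ TrivSqZeroExt.fst x = 0 := by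
    rw [DualNumber.maximalIdeal_eq_span_singleton_eps, Ideal.mem_span_singleton,
      DualNumber.fst_eq_zero_iff_eps_dvd]
  have hsq : IsLocalRing.maximalIdeal (DualNumber k) ^ 2 = ⊥ := by
    rw [DualNumber.maximalIdeal_eq_span_singleton_eps, Ideal.span_singleton_pow, pow_two,
      DualNumber.eps_mul_eps, Ideal.span_singleton_zero]
  { carrier := DualNumber k
    isAdicComplete :=
      { haus' := fun x hx => by
          have h := hx 2
          rw [hsq] at h
          simpa [SModEq.zero] using h
        prec' := fun f hf => by
          refine ⟨f 2, fun n => ?_⟩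
          rcases le_total n 2 with h | h
          · exact hf h
          · have h2 := hf h
            rw [hsq, Submodule.bot_smul, SModEq.bot] at h2
            rw [h2]
            exact SModEq.rfl }
    bijective_residue := by
      refine ⟨(algebraMap k _).injective, fun y => ?_⟩
      obtain ⟨x, rfl⟩ := IsLocalRing.residue_surjective y
      refine ⟨TrivSqZeroExt.fst x, ?_⟩
      rw [IsScalarTower.algebraMap_apply k (DualNumber k), IsLocalRing.ResidueField.algebraMap_eq,
        ← sub_eq_zero, ← map_sub, IsLocalRing.residue_eq_zero_iff, hmax]
      exact sub_self _ }

end CHat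

/-! ### Lifts and deformations -/

section Deformations

variable {k Λ : Type u} [Field k] [Ring Λ] [Algebra k Λ]

/-- The reduction `k ⊗_R M` of a module `M` over `R`, for the natural surjection `R → k`. -/
def Reduction (R : CHat k) (M : Type u) [AddCommGroup M] [Module R M] : Type u :=
  BaseChange R.residue M

namespace Reduction

variable (R : CHat k) (M : Type u) [AddCommGroup M] [Module R M]

noncomputable instance : AddCommGroup (Reduction R M) :=
  inferInstanceAs (AddCommGroup (BaseChange R.residue M))

/-- The reduction of an `R ⊗ Λ`-module is a `k ⊗ Λ`-module, i.e. a `Λ`-module. -/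
noncomputable instance [Module (R ⊗[k] Λ) M] [IsScalarTower R (R ⊗[k] Λ) M] :
    Module Λ (Reduction R M) :=
  Module.compHom (BaseChange R.residue M)
    (Algebra.TensorProduct.includeRight : Λ →ₐ[k] k ⊗[k] Λ).toRingHom

/-- A `k ⊗ Λ`-linear isomorphism onto `k ⊗_R M` is `Λ`-linear. -/
noncomputable def ofEquiv {S : CHat k} {M N : Type u} [AddCommGroup M] [Module R M]
    [Module (R ⊗[k] Λ) M] [IsScalarTower R (R ⊗[k] Λ) M]
    [AddCommGroup N] [Module S N] [Module (S ⊗[k] Λ) N] [IsScalarTower S (S ⊗[k] Λ) N]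
    (e : BaseChange R.residue M ≃ₗ[k ⊗[k] Λ] BaseChange S.residue N) :
    Reduction R M ≃ₗ[Λ] Reduction S N where
  toFun := e
  invFun := e.symm
  left_inv := e.left_inv
  right_inv := e.right_inv
  map_add' := e.map_add
  map_smul' l x := e.map_smul ((1 : k) ⊗ₜ[k] l) x

variable {R M} in
/-- The isomorphism `k ⊗_R e`. -/
noncomputable def congr {M' : Type u} [AddCommGroup M'] [Module R M']
    [Module (R ⊗[k] Λ) M] [IsScalarTower R (R ⊗[k] Λ) M]
    [Module (R ⊗[k] Λ) M'] [IsScalarTower R (R ⊗[k] Λ) M'] (e : M ≃ₗ[R ⊗[k] Λ] M') :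
    Reduction R M ≃ₗ[Λ] Reduction R M' :=
  ofEquiv R (BaseChange.congr R.residue e)

variable {R} in
/-- The isomorphism `k ⊗_S (S ⊗_{R,α} M) ≅ k ⊗_R M`. -/
noncomputable def baseChangeEquiv {S : CHat k} (α : R ⟶ S)
    [Module (R ⊗[k] Λ) M] [IsScalarTower R (R ⊗[k] Λ) M] :
    Reduction S (BaseChange α.toAlgHom M) ≃ₗ[Λ] Reduction R M :=
  ofEquiv S (BaseChange.compEquiv M S.residue R.residue α.residue_comp.symm)

end Reduction

variable (Λ) (V : Type u) [AddCommGroup V] [Module Λ V]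

/-- A lift `(M, φ)` of `V` over `R`: a finitely generated `R ⊗ Λ`-module `M` which is free over
`R`, together with an isomorphism `φ : k ⊗_R M → V` of `Λ`-modules. -/
structure Lift (R : CHat k) where
  /-- The underlying module. -/
  M : Type u
  [addCommGroup : AddCommGroup M]
  [module : Module R M]
  [moduleTensor : Module (R ⊗[k] Λ) M]
  [isScalarTower : IsScalarTower R (R ⊗[k] Λ) M]
  [finite : Module.Finite (R ⊗[k] Λ) M]
  [free : Module.Free R M]
  /-- The isomorphism with `V`. -/
  φ : Reduction R M ≃ₗ[Λ] V

attribute [instance] Lift.addCommGroup Lift.module Lift.moduleTensor Lift.isScalarTower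
  Lift.finite Lift.free

variable {Λ V}

namespace Lift

/-- Two lifts `(M, φ)` and `(M', φ')` are isomorphic if there is an `R ⊗ Λ`-isomorphism
`f : M → M'` with `φ' ∘ (k ⊗_R f) = φ`. -/
def Iso {R : CHat k} (L L' : Lift Λ V R) : Prop :=
  ∃ f : L.M ≃ₗ[R ⊗[k] Λ] L'.M, (Reduction.congr f).trans L'.φ = L.φ

/-- Two lifts are weakly isomorphic if the underlying `R ⊗ Λ`-modules are isomorphic. -/
def WeakIso {R : CHat k} (L L' : Lift Λ V R) : Prop :=
  Nonempty (L.M ≃ₗ[R ⊗[k] Λ] L'.M)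

/-- The lift `(S ⊗_{R,α} M, φ_α)` of `V` over `S`. -/
noncomputable abbrev baseChange {R S : CHat k} (α : R ⟶ S) (L : Lift Λ V R) : Lift Λ V S where
  M := BaseChange α.toAlgHom L.M
  φ := (Reduction.baseChangeEquiv L.M α).trans L.φ

theorem Iso.weakIso {R : CHat k} {L L' : Lift Λ V R} (h : L.Iso L') : L.WeakIso L' :=
  ⟨h.choose⟩

/-- The value of `φ` at the pure tensor `c ⊗ m`. -/
noncomputable def φTmul {R : CHat k} (L : Lift Λ V R) (c : k) (m : L.M) : V :=
  L.φ (BaseChange.tmul R.residue c m : BaseChange R.residue L.M)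

theorem φTmul_add {R : CHat k} (L : Lift Λ V R) (c : k) (m m' : L.M) :
    L.φTmul c (m + m') = L.φTmul c m + L.φTmul c m' :=
  (congrArg L.φ (BaseChange.tmul_add c m m')).trans (map_add L.φ _ _)

theorem φTmul_smul {R : CHat k} (L : Lift Λ V R) (c : k) (r : R) (m : L.M) :
    L.φTmul c (r • m) = L.φTmul (R.residue r * c) m :=
  congrArg L.φ (BaseChange.tmul_smul c r m)

/-- A map is compatible with `φ` if it is so on tensors `c ⊗ m`. -/
theorem iso_iff {R : CHat k} {L L' : Lift Λ V R} :
    L.Iso L' ↔ ∃ f : L.M ≃ₗ[R ⊗[k] Λ] L'.M, ∀ c m, L'.φTmul c (f m) = L.φTmul c m := by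
  refine exists_congr fun f => ⟨fun h c m => ?_, fun h => LinearEquiv.ext fun x => ?_⟩
  · rw [φTmul, φTmul, ← h]
    exact (congrArg L'.φ (BaseChange.congr_tmul f c m)).symm
  · induction x using BaseChange.induction with
    | add x y hx hy =>
      exact (map_add ((Reduction.congr f).trans L'.φ) x y).trans
        ((congrArg₂ _ hx hy).trans (map_add L.φ x y).symm)
    | tmul c m => exact (congrArg L'.φ (BaseChange.congr_tmul f c m)).trans (h c m)

theorem baseChange_φTmul {R S : CHat k} (α : R ⟶ S) (L : Lift Λ V R) (c : k) (s : S) (m : L.M) :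
    (L.baseChange α).φTmul c (BaseChange.tmul α.toAlgHom s m) = L.φTmul (c * S.residue s) m :=
  congrArg L.φ (BaseChange.compEquiv_tmul (Λ := Λ) S.residue R.residue α.residue_comp.symm c s m)

theorem baseChange_iso {R S : CHat k} (α : R ⟶ S) (L : Lift Λ V R) (L' : Lift Λ V S)
    (f : BaseChange α.toAlgHom L.M ≃ₗ[S ⊗[k] Λ] L'.M)
    (h : ∀ c s m, L'.φTmul c (f (BaseChange.tmul α.toAlgHom s m)) =
      L.φTmul (c * S.residue s) m) : (L.baseChange α).Iso L' := by
  refine iso_iff.2 ⟨f, fun c x => ?_⟩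
  induction x using BaseChange.induction with
  | add x y hx hy => rw [map_add, φTmul_add, φTmul_add, hx, hy]
  | tmul s m => rw [h, baseChange_φTmul]

theorem Iso.baseChange {R S : CHat k} (α : R ⟶ S) {L L' : Lift Λ V R} (h : L.Iso L') :
    (L.baseChange α).Iso (L'.baseChange α) := by
  obtain ⟨f, hf⟩ := iso_iff.1 h
  refine baseChange_iso α L _ (BaseChange.congr α.toAlgHom f) fun c s m => ?_
  rw [BaseChange.congr_tmul, baseChange_φTmul, hf]

theorem WeakIso.baseChange {R S : CHat k} (α : R ⟶ S) {L L' : Lift Λ V R} (h : L.WeakIso L') :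
    (L.baseChange α).WeakIso (L'.baseChange α) :=
  h.map fun f => BaseChange.congr α.toAlgHom f

theorem baseChange_id_iso {R : CHat k} (L : Lift Λ V R) : (L.baseChange (𝟙 R)).Iso L := by
  refine baseChange_iso _ L _ (BaseChange.idEquiv L.M _ rfl) fun c s m => ?_
  rw [BaseChange.idEquiv_tmul, φTmul_smul, mul_comm]

theorem baseChange_comp_iso {R S T : CHat k} (α : R ⟶ S) (β : S ⟶ T) (L : Lift Λ V R) :
    ((L.baseChange α).baseChange β).Iso (L.baseChange (α ≫ β)) := by
  refine baseChange_iso β (L.baseChange α) _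
    (BaseChange.compEquiv L.M β.toAlgHom (α ≫ β).toAlgHom rfl) fun c t x => ?_
  induction x using BaseChange.induction with
  | add x y hx hy => rw [BaseChange.tmul_add, map_add, φTmul_add, φTmul_add, hx, hy]
  | tmul s m =>
    have h : T.residue (β.toAlgHom s) = S.residue s := DFunLike.congr_fun β.residue_comp s
    rw [BaseChange.compEquiv_tmul, baseChange_φTmul, baseChange_φTmul, map_mul, h, mul_assoc]

variable (Λ V) in
/-- The equivalence relation of isomorphism of lifts. -/
def isoSetoid (R : CHat k) : Setoid (Lift Λ V R) where
  r := Iso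
  iseqv :=
    { refl := fun L => iso_iff.2 ⟨LinearEquiv.refl _ _, fun _ _ => rfl⟩
      symm := fun {L L'} h => by
        obtain ⟨f, hf⟩ := iso_iff.1 h
        refine iso_iff.2 ⟨f.symm, fun c m => ?_⟩
        rw [← hf, LinearEquiv.apply_symm_apply]
      trans := fun {L L' L''} h h' => by
        obtain ⟨f, hf⟩ := iso_iff.1 h
        obtain ⟨g, hg⟩ := iso_iff.1 h'
        exact iso_iff.2 ⟨f.trans g, fun c m => (hg c (f m)).trans (hf c m)⟩ }

variable (Λ V) in
/-- The equivalence relation of weak isomorphism of lifts. -/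
def weakIsoSetoid (R : CHat k) : Setoid (Lift Λ V R) where
  r := WeakIso
  iseqv :=
    { refl := fun _ => ⟨LinearEquiv.refl _ _⟩
      symm := fun h => h.map LinearEquiv.symm
      trans := fun ⟨f⟩ ⟨g⟩ => ⟨f.trans g⟩ }

end Lift

variable (k Λ V)

/-- The deformation functor of `V`: it maps `R` to the set of isomorphism classes `[M, φ]` of lifts
of `V` over `R`, and `α : R → S` to `[M, φ] ↦ [S ⊗_{R,α} M, φ_α]`. -/
noncomputable def deformationFunctor : CHat k ⥤ Type (u + 1) where
  obj R := Quotient (Lift.isoSetoid Λ V R)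
  map α := TypeCat.ofHom (Quotient.map (Lift.baseChange α) fun _ _ h => h.baseChange α)
  map_id R := by
    ext d
    induction d using Quotient.inductionOn with
    | h L => exact Quotient.sound L.baseChange_id_iso
  map_comp α β := by
    ext d
    induction d using Quotient.inductionOn with
    | h L => exact (Quotient.sound (L.baseChange_comp_iso α β)).symm

/-- The weak deformation functor of `V`: it maps `R` to the set of isomorphism classes `[M]` of
the `R ⊗ Λ`-modules underlying lifts of `V` over `R`, and `α : R → S` to `[M] ↦ [S ⊗_{R,α} M]`. -/
noncomputable def weakDeformationFunctor : CHat k ⥤ Type (u + 1) where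
  obj R := Quotient (Lift.weakIsoSetoid Λ V R)
  map α := TypeCat.ofHom (Quotient.map (Lift.baseChange α) fun _ _ h => h.baseChange α)
  map_id R := by
    ext d
    induction d using Quotient.inductionOn with
    | h L => exact Quotient.sound L.baseChange_id_iso.weakIso
  map_comp α β := by
    ext d
    induction d using Quotient.inductionOn with
    | h L => exact (Quotient.sound (L.baseChange_comp_iso α β).weakIso).symm

/-- The natural transformation `[M, φ] ↦ [M]`. -/
noncomputable def toWeakDeformation : deformationFunctor k Λ V ⟶ weakDeformationFunctor k Λ V where
  app R := TypeCat.ofHom (Quotient.map id fun _ _ h => h.weakIso)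
  naturality R S α := by
    ext d
    induction d using Quotient.inductionOn with
    | h L => rfl

variable {k Λ V}

/-- `R` and the deformation `u` of `V` over `R` are a versal deformation ring and a versal
deformation of `V`. -/
def IsVersalDeformation (R : CHat k) (u : (deformationFunctor k Λ V).obj R) : Prop :=
  (∀ (S : CHat k) (d : (deformationFunctor k Λ V).obj S),
    ∃ ψ : R ⟶ S, (deformationFunctor k Λ V).map ψ u = d) ∧
  ∀ d : (deformationFunctor k Λ V).obj (CHat.dualNumber k),
    ∃! ψ : R ⟶ CHat.dualNumber k, (deformationFunctor k Λ V).map ψ u = d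

/-- `R` and the deformation `u` of `V` over `R` are a universal deformation ring and a universal
deformation of `V`. -/
def IsUniversalDeformation (R : CHat k) (u : (deformationFunctor k Λ V).obj R) : Prop :=
  ∀ (S : CHat k) (d : (deformationFunctor k Λ V).obj S),
    ∃! ψ : R ⟶ S, (deformationFunctor k Λ V).map ψ u = d

variable (k Λ V) in
/-- `V` has a universal deformation ring. -/
def HasUniversalDeformationRing : Prop :=
  ∃ (R : CHat k) (u : (deformationFunctor k Λ V).obj R), IsUniversalDeformation R u

variable (k Λ V) in
/-- Every versal deformation ring of `V` is universal. -/
def VersalDeformationsAreUniversal : Prop :=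
  ∀ (R : CHat k) (u : (deformationFunctor k Λ V).obj R),
    IsVersalDeformation R u → IsUniversalDeformation R u

end Deformations

end ModuleDeformation

/-!
Lifts of `V` over `R` are studied through matrices. A `k`-basis `b` of `V` turns `V` into a matrix
representation `ρ` of `Λ`; an `R`-basis of a lift which reduces to `b` turns the lift into a matrix
representation `σ` over `R` with reduction `ρ`, and isomorphism of lifts becomes conjugation by
matrices congruent to `1` modulo the maximal ideal (`Lift.Represents.iso_iff`).

The hypotheses on `V` enter only through `exists_commutant_lift`: every endomorphism of `V` lifts to
an endomorphism of every lift of `V`. Scalars lift. As the stable endomorphism ring is `k`, it is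
enough to lift a map which factors through a projective module, that is, a sum of maps
`v ↦ h(v) w` with `h : V → Λ` linear. A lift of `w` is available because `Λ` is free, and `h` lifts
because `Ext¹(V, Λ) = 0`: the obstruction lives in the derivations `Λ → Hom_k(V, Λ)` modulo the
inner ones (`ExtOneVanishes.derivation_inner`), and exactness of the reduction of
`Hom_R(M, RΛ) → Hom_k(Λ, Hom_R(M, RΛ)) → Hom_k(Λ ⊗ Λ, Hom_R(M, RΛ))` gives surjectivity of
reduction on the kernels of the first maps (`exists_mem_ker_of_exact_reduction`). In particular an
isomorphism of underlying modules can be corrected by an automorphism to one compatible with the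
identifications of the reductions with `V`, so that `[M, φ] ↦ [M]` is bijective.

A universal deformation ring is constructed without Schlessinger's criterion. Let `s` be a
generalized inverse of the linear map `bracket`, the differential at `1` of the conjugation action
on `ρ`. The lifts `σ` with `s (σ - ρ) = 0` form a slice to this action.
* Every lift is conjugate to one in the slice, by a contraction argument (`exists_conj_mem_slice`).
* Two conjugate lifts in the slice are equal (`eq_of_conj_of_mem_slice`), since the stabilizer of
  `ρ` lifts to the stabilizer of every lift: the conjugating matrix can be corrected by elements of
  the commutant so as to be congruent to `1` modulo arbitrarily high powers of the maximal ideal.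
* The lifts in the slice are represented by a quotient of a power series ring whose variables are
  the matrix entries of `σ - ρ` (`exists_universal_slice`).

A versal deformation ring is compared with the universal one. The composite endomorphism of the
versal ring is the identity on tangent spaces by the uniqueness over the dual numbers, hence can be
cancelled by Nakayama's lemma, and uniqueness for the versal ring follows.

The construction uses of `V` only that `Ext¹(V, Λ) = 0` and that endomorphisms are stably scalar.
For a projective cover `P → V` with kernel `ΩV`, endomorphisms of `ΩV` extend to `P` because
`Ext¹(V, Λ) = 0`, so that `ΩV` has the same stable endomorphism ring
(`nonempty_stableEnd_ker_algEquiv`); and `Ext¹(ΩV, Λ) = 0` by Schanuel's lemma, since a syzygy of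
this kind occurs in the totally acyclic complex of `V` (`IsGorensteinProjective.exists_presentation`
and `ExtOneVanishes.ker_of_ker`).
-/

namespace ModuleDeformation

/-! ### Vanishing of `Ext¹(-, Λ)` -/

section Ext

variable {Λ : Type u} [Ring Λ]

theorem exists_comp_eq_of_ker_le {A B N : Type u} [AddCommGroup A] [Module Λ A]
    [AddCommGroup B] [Module Λ B] [AddCommGroup N] [Module Λ N] (c : A →ₗ[Λ] B)
    (hc : Function.Surjective c) (φ : A →ₗ[Λ] N) (h : ∀ a, c a = 0 → φ a = 0) :
    ∃ ψ : B →ₗ[Λ] N, ψ ∘ₗ c = φ := by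
  refine ⟨(LinearMap.ker c).liftQ φ (fun a ha => h a ha) ∘ₗ
    (LinearMap.quotKerEquivOfSurjective c hc).symm.toLinearMap, ?_⟩
  ext a
  have : (LinearMap.quotKerEquivOfSurjective c hc).symm (c a) = (LinearMap.ker c).mkQ a := by
    rw [LinearEquiv.symm_apply_eq]
    rfl
  simp only [LinearMap.comp_apply, LinearEquiv.coe_coe, this]
  rfl

variable (Λ) in
/-- The condition `Ext¹_Λ(X, Λ) = 0`, phrased as an extension property: for every surjection
`π : E → X`, linear forms on the kernel of `π` extend to `E`. -/
def ExtOneVanishes (X : Type u) [AddCommGroup X] [Module Λ X] : Prop :=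
  ∀ (E : Type u) [AddCommGroup E] [Module Λ E] (π : E →ₗ[Λ] X), Function.Surjective π →
    ∀ f : LinearMap.ker π →ₗ[Λ] Λ, ∃ g : E →ₗ[Λ] Λ, ∀ x : LinearMap.ker π, g x = f x

/-- The extension property may be tested on a single projective presentation. -/
theorem ExtOneVanishes.of_projective {X Q : Type u} [AddCommGroup X] [Module Λ X]
    [AddCommGroup Q] [Module Λ Q] [Module.Projective Λ Q] (q : Q →ₗ[Λ] X)
    (hq : Function.Surjective q)
    (H : ∀ f : LinearMap.ker q →ₗ[Λ] Λ, ∃ g : Q →ₗ[Λ] Λ, ∀ x : LinearMap.ker q, g x = f x) :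
    ExtOneVanishes Λ X := by
  intro E _ _ π hπ f
  obtain ⟨h, hh⟩ := Module.projective_lifting_property π q hπ
  have hh' (y : Q) : π (h y) = q y := LinearMap.congr_fun hh y
  obtain ⟨g, hg⟩ := H (f ∘ₗ (h ∘ₗ (LinearMap.ker q).subtype).codRestrict (LinearMap.ker π)
    (fun y => by simp [hh']))
  have hc : Function.Surjective ((LinearMap.ker π).subtype.coprod h) := by
    intro e
    obtain ⟨y, hy⟩ := hq (π e)
    exact ⟨(⟨e - h y, by simp [hh', hy]⟩, y), by simp⟩
  obtain ⟨ψ, hψ⟩ := exists_comp_eq_of_ker_le _ hc (f.coprod g) (by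
    rintro ⟨x, y⟩ hxy
    have hxy' : (x : E) + h y = 0 := by simpa using hxy
    have hy : q y = 0 := by
      have := congrArg π hxy'
      simpa [hh'] using this
    have h1 := hg ⟨y, hy⟩
    have h2 : (h ∘ₗ (LinearMap.ker q).subtype).codRestrict (LinearMap.ker π)
        (fun y => by simp [hh']) ⟨y, hy⟩ = -x := by
      exact Subtype.ext (eq_neg_of_add_eq_zero_right hxy')
    rw [LinearMap.comp_apply, h2, map_neg] at h1
    simpa using by rw [h1, add_neg_cancel])
  refine ⟨ψ, fun x => ?_⟩
  have := LinearMap.congr_fun hψ (x, 0)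
  simpa using this

/-- The extension property for values in `Λ` gives it for values in every finitely generated
projective module. -/
theorem ExtOneVanishes.exists_extension {X E N : Type u} [AddCommGroup X] [Module Λ X]
    (hX : ExtOneVanishes Λ X) [AddCommGroup E] [Module Λ E] [AddCommGroup N] [Module Λ N]
    [Module.Finite Λ N] [Module.Projective Λ N] (π : E →ₗ[Λ] X) (hπ : Function.Surjective π)
    (f : LinearMap.ker π →ₗ[Λ] N) :
    ∃ g : E →ₗ[Λ] N, ∀ x : LinearMap.ker π, g x = f x := by
  obtain ⟨n, q, hq⟩ := Module.Finite.exists_fin' Λ N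
  obtain ⟨j, hj⟩ := Module.projective_lifting_property q LinearMap.id hq
  choose g hg using fun i => hX E π hπ (LinearMap.proj i ∘ₗ j ∘ₗ f)
  refine ⟨q ∘ₗ LinearMap.pi g, fun x => ?_⟩
  have : LinearMap.pi g (x : E) = j (f x) := by
    ext i
    simp [hg]
  rw [LinearMap.comp_apply, this]
  exact LinearMap.congr_fun hj (f x)

/-- If `A → B → C → X → 0` is exact with `C` projective, and `Hom(-, Λ)` keeps it exact at `B`,
then `Ext¹(X, Λ) = 0`. -/
theorem ExtOneVanishes.of_exact {A B C X : Type u} [AddCommGroup A] [Module Λ A]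
    [AddCommGroup B] [Module Λ B] [AddCommGroup C] [Module Λ C] [AddCommGroup X] [Module Λ X]
    [Module.Projective Λ C] {d : A →ₗ[Λ] B} {d' : B →ₗ[Λ] C} {q : C →ₗ[Λ] X}
    (h : ∀ a, d' (d a) = 0) (h' : Function.Exact d' q) (hq : Function.Surjective q)
    (H : ∀ f : B →ₗ[Λ] Λ, f ∘ₗ d = 0 → ∃ g : C →ₗ[Λ] Λ, g ∘ₗ d' = f) :
    ExtOneVanishes Λ X := by
  refine .of_projective q hq fun f => ?_
  let d'' : B →ₗ[Λ] LinearMap.ker q := d'.codRestrict _ fun b => (h' _).2 ⟨b, rfl⟩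
  obtain ⟨g, hg⟩ := H (f ∘ₗ d'') (by
    ext a
    have : d'' (d a) = 0 := Subtype.ext (h a)
    simp [this])
  refine ⟨g, fun x => ?_⟩
  obtain ⟨b, hb⟩ := (h' x).1 x.2
  have h1 := LinearMap.congr_fun hg b
  have h2 : d'' b = x := Subtype.ext hb
  rw [LinearMap.comp_apply, hb, LinearMap.comp_apply, h2] at h1
  exact h1

/-- Vanishing of `Ext¹(K, Λ)` does not depend on the choice of the syzygy `K` (Schanuel). -/
theorem ExtOneVanishes.ker_of_ker {V P Q : Type u} [AddCommGroup V] [Module Λ V]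
    [AddCommGroup P] [Module Λ P] [AddCommGroup Q] [Module Λ Q] [Module.Projective Λ P]
    [Module.Projective Λ Q] {p : P →ₗ[Λ] V} {q : Q →ₗ[Λ] V} (hp : Function.Surjective p)
    (hq : Function.Surjective q) (H : ExtOneVanishes Λ (LinearMap.ker q)) :
    ExtOneVanishes Λ (LinearMap.ker p) := by
  intro E _ _ π hπ f
  obtain ⟨α, hα⟩ := Module.projective_lifting_property q p hq
  obtain ⟨β, hβ⟩ := Module.projective_lifting_property p q hp
  have hα' (y) : q (α y) = p y := LinearMap.congr_fun hα y
  have hβ' (y) : p (β y) = q y := LinearMap.congr_fun hβ y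
  let α' : LinearMap.ker p →ₗ[Λ] LinearMap.ker q := α.restrict fun x hx => by
    rw [LinearMap.mem_ker] at hx ⊢; rw [hα', hx]
  let β' : LinearMap.ker q →ₗ[Λ] LinearMap.ker p := β.restrict fun x hx => by
    rw [LinearMap.mem_ker] at hx ⊢; rw [hβ', hx]
  let γ : P →ₗ[Λ] LinearMap.ker p := (β ∘ₗ α - LinearMap.id).codRestrict _ fun x => by
    simp [hα', hβ']
  obtain ⟨γ', hγ⟩ := Module.projective_lifting_property π γ hπ
  have hγ' (y) : π (γ' y) = γ y := LinearMap.congr_fun hγ y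
  -- the pullback of `π` along `β'`
  let D : E × LinearMap.ker q →ₗ[Λ] LinearMap.ker p := π.coprod (-β')
  have hD (z : E × LinearMap.ker q) : z ∈ LinearMap.ker D ↔ π z.1 = β' z.2 := by
    rw [LinearMap.mem_ker, LinearMap.coprod_apply, LinearMap.neg_apply, ← sub_eq_add_neg,
      sub_eq_zero]
  let π' : LinearMap.ker D →ₗ[Λ] LinearMap.ker q := LinearMap.snd _ _ _ ∘ₗ (LinearMap.ker D).subtype
  have hπ' : Function.Surjective π' := by
    intro x
    obtain ⟨e, he⟩ := hπ (β' x)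
    exact ⟨⟨(e, x), (hD _).2 he⟩, rfl⟩
  obtain ⟨g, hg⟩ := H _ π' hπ' (f ∘ₗ (LinearMap.fst _ _ _ ∘ₗ (LinearMap.ker D).subtype ∘ₗ
    (LinearMap.ker π').subtype).codRestrict (LinearMap.ker π) (fun z => by
      have h1 := (hD _).1 z.1.2
      have h2 : z.1.1.2 = 0 := z.2
      rw [h2, map_zero] at h1
      exact h1))
  have hmem (e : E) : ((LinearMap.id + γ' ∘ₗ (LinearMap.ker p).subtype ∘ₗ π).prod (α' ∘ₗ π)) e ∈
      LinearMap.ker D := by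
    refine (hD _).2 (Subtype.ext ?_)
    have h1 : π (γ' (π e)) = γ (π e) := hγ' _
    simp [h1, α', β', γ]
  refine ⟨g ∘ₗ LinearMap.codRestrict _ _ hmem, fun x => ?_⟩
  · have hx : π (x : E) = 0 := x.2
    have := hg ⟨⟨((x : E), 0), (hD _).2 (by simp [hx])⟩, rfl⟩
    refine Eq.trans (congrArg g (Subtype.ext ?_)) (this.trans (congrArg f (Subtype.ext rfl)))
    simp [hx]

variable {V : Type u} [AddCommGroup V] [Module Λ V]

/-- A Gorenstein-projective module and one of its syzygies have vanishing `Ext¹(-, Λ)`: both are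
cokernels in an acyclic complex of projectives which stays acyclic under `Hom(-, Λ)`. -/
theorem IsGorensteinProjective.exists_presentation (hV : IsGorensteinProjective Λ V) :
    ExtOneVanishes Λ V ∧ ∃ (Q : Type u) (_ : AddCommGroup Q) (_ : Module Λ Q) (q : Q →ₗ[Λ] V),
      Module.Projective Λ Q ∧ Function.Surjective q ∧ ExtOneVanishes Λ (LinearMap.ker q) := by
  obtain ⟨P, _, _, d, hP, hd, hd', ⟨e⟩⟩ := hV
  let q : P 1 →ₗ[Λ] V := e.toLinearMap ∘ₗ (LinearMap.range (d 0)).mkQ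
  have hq : Function.Surjective q := e.surjective.comp (Submodule.mkQ_surjective _)
  have hker : LinearMap.ker q = LinearMap.range (d 0) := by
    ext x
    simp [q]
  have hex : Function.Exact (d 0) q := LinearMap.exact_iff.2 hker
  refine ⟨?_, P 1, inferInstance, inferInstance, q, hP 1, hq, ?_⟩
  · have := hP (0 + 1)
    exact ExtOneVanishes.of_exact (d := d (-1)) (d' := d 0) (q := q)
      (fun a => (hd (-1)).apply_apply_eq_zero a) hex hq
      (fun f hf => (hd' (-1) f).1 hf)
  · have := hP 0
    let d0 : P 0 →ₗ[Λ] LinearMap.ker q :=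
      (d 0).codRestrict _ fun b => (hex _).2 ⟨b, rfl⟩
    refine ExtOneVanishes.of_exact (d := d (-2)) (d' := d (-1)) (q := d0)
      (fun a => (hd (-2)).apply_apply_eq_zero a) ?_ ?_
      (fun f hf => (hd' (-2) f).1 hf)
    · intro (b : P (-1 + 1))
      exact Subtype.ext_iff.trans (hd (-1) b)
    · rintro ⟨x, hx⟩
      obtain ⟨b, hb⟩ := (hex x).1 hx
      exact ⟨b, Subtype.ext hb⟩

end Ext

/-! ### The stable endomorphism ring and syzygies -/

section Stable

variable {k Λ V : Type u} [Field k] [Ring Λ] [Algebra k Λ] [AddCommGroup V] [Module k V]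
  [Module Λ V] [IsScalarTower k Λ V]

theorem projectiveIdeal_mk_eq_mk {f g : Module.End Λ V} :
    ((f : StableEnd Λ V) = (g : StableEnd Λ V)) ↔ FactorsThroughProjective (f - g) := by
  rw [RingCon.eq, TwoSidedIdeal.rel_iff]
  exact TwoSidedIdeal.mem_mk' ..

/-- The stable endomorphism ring is `k` precisely when, modulo maps factoring through projective
modules, every endomorphism is a scalar and the identity is not zero. -/
theorem nonempty_stableEnd_algEquiv_iff :
    Nonempty (StableEnd Λ V ≃ₐ[k] k) ↔
      (∀ f : Module.End Λ V, ∃ c : k, FactorsThroughProjective (f - algebraMap k _ c)) ∧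
        ¬ FactorsThroughProjective (1 : Module.End Λ V) := by
  constructor
  · rintro ⟨e⟩
    refine ⟨fun f => ⟨e f, ?_⟩, fun h => ?_⟩
    · rw [← projectiveIdeal_mk_eq_mk]
      exact e.injective (e.commutes (e f)).symm
    · rw [← sub_zero 1, ← projectiveIdeal_mk_eq_mk] at h
      have h1 : (1 : StableEnd Λ V) = 0 := h
      have h2 := congrArg e h1
      rw [map_one, map_zero] at h2
      exact one_ne_zero h2
  · rintro ⟨h1, h2⟩
    have : Nontrivial (StableEnd Λ V) := by
      refine ⟨1, 0, fun h => h2 ?_⟩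
      rw [← sub_zero 1, ← projectiveIdeal_mk_eq_mk]
      exact h
    refine ⟨(AlgEquiv.ofBijective (Algebra.ofId k (StableEnd Λ V))
      ⟨(algebraMap k _).injective, fun x => ?_⟩).symm⟩
    obtain ⟨f, rfl⟩ : ∃ f : Module.End Λ V, (f : StableEnd Λ V) = x := Quot.exists_rep x
    obtain ⟨c, hc⟩ := h1 f
    exact ⟨c, (projectiveIdeal_mk_eq_mk.2 hc).symm⟩

variable {P : Type u} [AddCommGroup P] [Module Λ P]

/-- Taking syzygies does not change the stable endomorphism ring, if `Ext¹(V, Λ) = 0`: then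
endomorphisms of the syzygy extend to the projective cover. -/
theorem nonempty_stableEnd_ker_algEquiv [IsNoetherianRing Λ] [Module k P] [IsScalarTower k Λ P]
    [Module.Finite Λ P] [Module.Projective Λ P] (hExt : ExtOneVanishes Λ V) {p : P →ₗ[Λ] V}
    (hp : Function.Surjective p) (h : Nonempty (StableEnd Λ V ≃ₐ[k] k)) :
    Nonempty (StableEnd Λ (LinearMap.ker p) ≃ₐ[k] k) := by
  rw [nonempty_stableEnd_algEquiv_iff] at h ⊢
  obtain ⟨h1, h2⟩ := h
  refine ⟨fun f => ?_, ?_⟩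
  · obtain ⟨F, hF⟩ := hExt.exists_extension p hp ((LinearMap.ker p).subtype ∘ₗ f)
    obtain ⟨f', hf'⟩ := exists_comp_eq_of_ker_le p hp (p ∘ₗ F) fun a ha => by
      have := hF ⟨a, ha⟩
      simp_all
    obtain ⟨c, Q, _, _, i, q, hQ, hc⟩ := h1 f'
    obtain ⟨q', hq'⟩ := Module.projective_lifting_property p q hp
    let H : P →ₗ[Λ] LinearMap.ker p :=
      (F - algebraMap k (Module.End Λ P) c - q' ∘ₗ i ∘ₗ p).codRestrict _ fun x => by
        have e1 := LinearMap.congr_fun hf' x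
        have e2 := LinearMap.congr_fun hc (p x)
        have e3 := LinearMap.congr_fun hq' (i (p x))
        simp only [LinearMap.comp_apply, LinearMap.sub_apply,
          Module.algebraMap_end_apply] at e1 e2 e3
        rw [LinearMap.mem_ker]
        simp only [LinearMap.comp_apply, LinearMap.sub_apply, Module.algebraMap_end_apply, map_sub,
          e3, ← e2, ← e1, LinearMap.map_smul_of_tower]
        abel
    refine ⟨c, P, inferInstance, inferInstance, (LinearMap.ker p).subtype, H, inferInstance, ?_⟩
    ext x
    have := hF x
    simp_all [H]
  · rintro ⟨Q, _, _, i, q, hQ, h1⟩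
    have hproj : Module.Projective Λ (LinearMap.ker p) := .of_split i q h1.symm
    obtain ⟨r, hr⟩ := hExt.exists_extension p hp LinearMap.id
    refine h2 ?_
    -- the section of `p` determined by the retraction `r`
    obtain ⟨s, hs⟩ := exists_comp_eq_of_ker_le p hp
      (LinearMap.id - (LinearMap.ker p).subtype ∘ₗ r) fun a ha => by
        have := hr ⟨a, ha⟩
        simp_all
    refine ⟨P, inferInstance, inferInstance, s, p, inferInstance, ?_⟩
    ext v
    obtain ⟨x, rfl⟩ := hp v
    have hsx : s (p x) = x - r x := LinearMap.congr_fun hs x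
    simp [hsx]

end Stable

/-! ### Lifting kernels of linear maps over local rings -/

section LinearAlgebra

/-- A linear map over a field has a reflexive generalized inverse. -/
theorem exists_generalizedInverse {K X Y : Type*} [Field K] [AddCommGroup X] [Module K X]
    [AddCommGroup Y] [Module K Y] (g : X →ₗ[K] Y) :
    ∃ t : Y →ₗ[K] X, g ∘ₗ t ∘ₗ g = g ∧ t ∘ₗ g ∘ₗ t = t := by
  obtain ⟨r, hr⟩ := g.rangeRestrict.exists_rightInverse_of_surjective g.range_rangeRestrict
  obtain ⟨t, ht⟩ := LinearMap.exists_extend r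
  have h1 (x : X) : g (t (g x)) = g x := by
    have e1 : t (g x) = r (g.rangeRestrict x) := LinearMap.congr_fun ht (g.rangeRestrict x)
    have e2 := LinearMap.congr_fun hr (g.rangeRestrict x)
    rw [e1]
    exact congrArg Subtype.val e2
  refine ⟨t ∘ₗ g ∘ₗ t, ?_, ?_⟩ <;> ext x <;> simp [h1]

open IsLocalRing in
/-- Let `A → B → C` be a complex of finite free modules over a local ring whose reduction to the
residue field is exact at `B`. Then the kernel of `A → B` surjects onto the kernel of its
reduction. A contracting homotopy `(s, t)` of the reduction at `B` lifts to maps with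
`f s + t g ≡ 1` modulo the maximal ideal. -/
theorem exists_mem_ker_of_exact_reduction {S κ : Type*} [CommRing S] [IsLocalRing S] [Field κ]
    (res : S →+* κ)
    {A B C A₀ B₀ C₀ : Type*} [AddCommGroup A] [Module S A] [AddCommGroup B] [Module S B]
    [AddCommGroup C] [Module S C] [AddCommGroup A₀] [Module κ A₀] [AddCommGroup B₀] [Module κ B₀]
    [AddCommGroup C₀] [Module κ C₀] [Module.Free S B] [Module.Finite S B] [Module.Free S C]
    (πA : A →ₛₗ[res] A₀) (πB : B →ₛₗ[res] B₀) (πC : C →ₛₗ[res] C₀)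
    (hA : Function.Surjective πA) (hBs : Function.Surjective πB)
    (hB : ∀ b, πB b = 0 → b ∈ maximalIdeal S • (⊤ : Submodule S B))
    {f : A →ₗ[S] B} {g : B →ₗ[S] C} {f₀ : A₀ →ₗ[κ] B₀} {g₀ : B₀ →ₗ[κ] C₀}
    (hf : ∀ a, πB (f a) = f₀ (πA a)) (hg : ∀ b, πC (g b) = g₀ (πB b))
    (hgf : ∀ a, g (f a) = 0) (hex : ∀ b, g₀ b = 0 → ∃ a, f₀ a = b) (a₀ : A₀) (ha₀ : f₀ a₀ = 0) :
    ∃ a, πA a = a₀ ∧ f a = 0 := by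
  obtain ⟨t₀, ht₀, -⟩ := exists_generalizedInverse g₀
  obtain ⟨s₀, hs₀⟩ := Module.projective_lifting_property f₀.rangeRestrict
    ((LinearMap.id - t₀ ∘ₗ g₀).codRestrict (LinearMap.range f₀) fun b => by
      refine hex _ ?_
      have := LinearMap.congr_fun ht₀ b
      exact (map_sub g₀ _ _).trans (sub_eq_zero.2 this.symm)) f₀.surjective_rangeRestrict
  have hst (b : B₀) : f₀ (s₀ b) + t₀ (g₀ b) = b := by
    have h1 := congrArg Subtype.val (LinearMap.congr_fun hs₀ b)
    have h2 : f₀ (s₀ b) = b - t₀ (g₀ b) := h1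
    rw [h2, sub_add_cancel]
  obtain ⟨s, hs⟩ : ∃ s : B →ₗ[S] A, ∀ b, πA (s b) = s₀ (πB b) := by
    choose v hv using fun i => hA (s₀ (πB (Module.Free.chooseBasis S B i)))
    refine ⟨(Module.Free.chooseBasis S B).constr S v, fun b => ?_⟩
    have : πA.comp ((Module.Free.chooseBasis S B).constr S v) = s₀.comp πB :=
      (Module.Free.chooseBasis S B).ext fun i => by simp [hv]
    exact LinearMap.congr_fun this b
  obtain ⟨t, ht⟩ : ∃ t : C →ₗ[S] B, ∀ c, πB (t c) = t₀ (πC c) := by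
    choose v hv using fun i => hBs (t₀ (πC (Module.Free.chooseBasis S C i)))
    refine ⟨(Module.Free.chooseBasis S C).constr S v, fun b => ?_⟩
    have : πB.comp ((Module.Free.chooseBasis S C).constr S v) = t₀.comp πC :=
      (Module.Free.chooseBasis S C).ext fun i => by simp [hv]
    exact LinearMap.congr_fun this b
  let D : B →ₗ[S] B := f ∘ₗ s + t ∘ₗ g
  have hD (b : B) : πB (D b) = πB b := by simp [D, hf, hs, ht, hg, hst]
  have hDm (b : B) : b - D b ∈ maximalIdeal S • (⊤ : Submodule S B) := hB _ (by simp [hD])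
  have hgD (b : B) : g (D b) = g (t (g b)) := by simp [D, hgf]
  have hjac : maximalIdeal S ≤ Ideal.jacobson ⊥ := maximalIdeal_le_jacobson _
  have hDsurj : Function.Surjective D := by
    rw [← LinearMap.range_eq_top, eq_top_iff]
    refine Submodule.le_of_le_smul_of_le_jacobson_bot Module.Finite.fg_top hjac fun b _ => ?_
    rw [← add_sub_cancel (D b) b]
    exact Submodule.add_mem_sup ⟨b, rfl⟩ (hDm b)
  -- `g t` is the identity modulo the maximal ideal on the image of `g`, hence injective there
  let w : LinearMap.range g →ₗ[S] LinearMap.range g :=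
    g.rangeRestrict ∘ₗ t ∘ₗ (LinearMap.range g).subtype
  have hw : Function.Surjective w := by
    rw [← LinearMap.range_eq_top, eq_top_iff]
    refine Submodule.le_of_le_smul_of_le_jacobson_bot Module.Finite.fg_top hjac ?_
    rintro ⟨_, b, rfl⟩ -
    have h1 : w ⟨g b, b, rfl⟩ = g.rangeRestrict (D b) := Subtype.ext (hgD b).symm
    have h2 : (⟨g b, b, rfl⟩ : LinearMap.range g) =
        w ⟨g b, b, rfl⟩ + g.rangeRestrict (b - D b) := by
      rw [h1, ← map_add, add_sub_cancel]
      rfl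
    rw [h2]
    refine Submodule.add_mem_sup ⟨_, rfl⟩ ?_
    have h3 := Submodule.mem_map_of_mem (f := g.rangeRestrict) (hDm b)
    rw [Submodule.map_smul''] at h3
    exact Submodule.smul_mono le_rfl le_top h3
  have hwinj : Function.Injective w := OrzechProperty.injective_of_surjective_endomorphism w hw
  obtain ⟨a, rfl⟩ := hA a₀
  obtain ⟨b, hb⟩ := hDsurj (f a)
  have hb0 : πB b = 0 := by rw [← hD, hb, hf, ha₀]
  have hgb : g b = 0 := by
    have h1 : w ⟨g b, b, rfl⟩ = w 0 := by
      rw [map_zero]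
      refine Subtype.ext ?_
      change g (t (g b)) = 0
      rw [← hgD, hb, hgf]
    exact congrArg Subtype.val (hwinj h1)
  refine ⟨a - s b, ?_, ?_⟩
  · simp [hs, hb0]
  · rw [map_sub, ← hb]
    simp [D, hgb]

end LinearAlgebra

section Intertwiners

variable {k Λ S : Type*} [Field k] [Ring Λ] [Algebra k Λ] [Module.Finite k Λ]
  [CommRing S] [Algebra k S] [IsLocalRing S]
  {m n : Type*} [Fintype m] [Fintype n] [DecidableEq m] [DecidableEq n]

/-- Let `τ` and `σ` be matrix representations over a local ring with reductions `τ₀` and `σ₀`. If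
all derivations with values in `Hom(σ₀, τ₀)` are inner, then intertwiners of `σ₀` and `τ₀` lift to
intertwiners of `σ` and `τ`. -/
theorem exists_intertwiner_lift (res : S →ₐ[k] k)
    (hres : ∀ s, res s = 0 → s ∈ IsLocalRing.maximalIdeal S)
    {τ : Λ →ₐ[k] Matrix m m S} {σ : Λ →ₐ[k] Matrix n n S}
    {τ₀ : Λ →ₐ[k] Matrix m m k} {σ₀ : Λ →ₐ[k] Matrix n n k}
    (hτ : ∀ l, (τ l).map res = τ₀ l) (hσ : ∀ l, (σ l).map res = σ₀ l)
    (hder : ∀ c : Λ →ₗ[k] Matrix m n k, (∀ l l', c (l * l') = τ₀ l * c l' + c l * σ₀ l') →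
      ∃ h : Matrix m n k, ∀ l, c l = τ₀ l * h - h * σ₀ l)
    (H₀ : Matrix m n k) (hH₀ : ∀ l, τ₀ l * H₀ = H₀ * σ₀ l) :
    ∃ H : Matrix m n S, H.map res = H₀ ∧ ∀ l, τ l * H = H * σ l := by
  classical
  let e := Module.finBasis k Λ
  have e_span (l : Λ) : l ∈ Submodule.span k (Set.range e) := e.span_eq ▸ Submodule.mem_top
  let N := Module.finrank k Λ
  -- The complex to which the lifting of kernels is applied is the start of the Hochschild complex:
  -- `f` maps a matrix to its inner derivation, and the kernel of `g` consists of the derivations,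
  -- given by their values on the basis `e`.
  let πA : Matrix m n S →ₛₗ[(res : S →+* k)] Matrix m n k :=
    { toFun M := M.map res
      map_add' M M' := by ext; simp
      map_smul' r M := by ext; simp }
  let πB : (Fin N → Matrix m n S) →ₛₗ[(res : S →+* k)] (Fin N → Matrix m n k) :=
    { toFun M a := πA (M a)
      map_add' M M' := by ext; simp
      map_smul' r M := by ext; simp }
  let πC : (Fin N → Fin N → Matrix m n S) →ₛₗ[(res : S →+* k)] (Fin N → Fin N → Matrix m n k) :=
    { toFun M a b := πA (M a b)
      map_add' M M' := by ext; simp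
      map_smul' r M := by ext; simp }
  have hres' (c : k) : res (algebraMap k S c) = c := res.commutes c
  have hA : Function.Surjective πA := fun M =>
    ⟨M.map (algebraMap k S), by ext; simp [πA, hres']⟩
  have πA_mul (M : Matrix m m S) (M' : Matrix m n S) :
    πA (M * M') = M.map res * πA M' := Matrix.map_mul (f := (res : S →+* k))
  have πA_mul' (M : Matrix m n S) (M' : Matrix n n S) :
    πA (M * M') = πA M * M'.map res := Matrix.map_mul (f := (res : S →+* k))
  have πA_smul (r : k) (M : Matrix m n S) : πA (r • M) = r • πA M := by ext; simp [πA]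
  let f : Matrix m n S →ₗ[S] (Fin N → Matrix m n S) :=
    { toFun H a := τ (e a) * H - H * σ (e a)
      map_add' H H' := by
        ext1 a
        simp only [Pi.add_apply, Matrix.mul_add, Matrix.add_mul]
        abel
      map_smul' r H := by ext1 a; simp [smul_sub] }
  let f₀ : Matrix m n k →ₗ[k] (Fin N → Matrix m n k) :=
    { toFun H a := τ₀ (e a) * H - H * σ₀ (e a)
      map_add' H H' := by
        ext1 a
        simp only [Pi.add_apply, Matrix.mul_add, Matrix.add_mul]
        abel
      map_smul' r H := by ext1 a; simp [smul_sub] }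
  let g : (Fin N → Matrix m n S) →ₗ[S] (Fin N → Fin N → Matrix m n S) :=
    { toFun c a b := ∑ d, algebraMap k S (e.repr (e a * e b) d) • c d - τ (e a) * c b -
        c a * σ (e b)
      map_add' c c' := by
        ext1 a; ext1 b
        simp only [Pi.add_apply, smul_add, Finset.sum_add_distrib, Matrix.mul_add, Matrix.add_mul]
        abel
      map_smul' r c := by
        ext1 a; ext1 b
        simp only [Pi.smul_apply, smul_sub, Finset.smul_sum, Matrix.mul_smul, Matrix.smul_mul,
          RingHom.id_apply, smul_comm r] }
  let g₀ : (Fin N → Matrix m n k) →ₗ[k] (Fin N → Fin N → Matrix m n k) :=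
    { toFun c a b := ∑ d, e.repr (e a * e b) d • c d - τ₀ (e a) * c b - c a * σ₀ (e b)
      map_add' c c' := by
        ext1 a; ext1 b
        simp only [Pi.add_apply, smul_add, Finset.sum_add_distrib, Matrix.mul_add, Matrix.add_mul]
        abel
      map_smul' r c := by
        ext1 a; ext1 b
        simp only [Pi.smul_apply, smul_sub, Finset.smul_sum, Matrix.mul_smul, Matrix.smul_mul,
          RingHom.id_apply, smul_comm r] }
  obtain ⟨H, hH, hfH⟩ := exists_mem_ker_of_exact_reduction (res : S →+* k) πA πB πC hA
    (fun M => ⟨fun a => (hA (M a)).choose, funext fun a => (hA (M a)).choose_spec⟩)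
    (fun b hb => by
      have hb' (a i j) : b a i j ∈ IsLocalRing.maximalIdeal S :=
        hres _ (congrFun (congrFun (congrFun hb a) i) j)
      have : b = ∑ a, ∑ i, ∑ j,
          b a i j • (Pi.single a (Matrix.single i j 1) : Fin N → Matrix m n S) := by
        conv_lhs => rw [← Finset.univ_sum_single b]
        refine Finset.sum_congr rfl fun a _ => ?_
        conv_lhs => rw [Matrix.matrix_eq_sum_single (b a)]
        rw [← LinearMap.coe_single (R := S), map_sum]
        refine Finset.sum_congr rfl fun i _ => ?_
        rw [map_sum]
        refine Finset.sum_congr rfl fun j _ => ?_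
        rw [← map_smul, Matrix.smul_single, smul_eq_mul, mul_one]
      rw [this]
      exact sum_mem fun a _ => sum_mem fun i _ => sum_mem fun j _ =>
        Submodule.smul_mem_smul (hb' a i j) Submodule.mem_top)
    (f := f) (g := g) (f₀ := f₀) (g₀ := g₀)
    (fun H => by ext1 a; simp [f, f₀, πB, πA_mul, πA_mul', hτ, hσ])
    (fun c => by ext1 a; ext1 b; simp [g, g₀, πB, πC, πA_mul, πA_mul', πA_smul, hτ, hσ])
    (fun H => by
      ext1 a; ext1 b
      have h1 : ∑ d, algebraMap k S (e.repr (e a * e b) d) • (τ (e d) * H - H * σ (e d)) =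
          τ (e a * e b) * H - H * σ (e a * e b) := by
        conv_rhs => rw [← e.sum_repr (e a * e b)]
        simp only [map_sum, map_smul, Matrix.sum_mul, Matrix.mul_sum, ← Finset.sum_sub_distrib,
          algebraMap_smul, smul_sub, Matrix.smul_mul, Matrix.mul_smul]
      simp only [f, g, LinearMap.coe_mk, AddHom.coe_mk, h1, map_mul, Pi.zero_apply, Matrix.mul_sub,
        Matrix.sub_mul, Matrix.mul_assoc]
      abel)
    (fun c hc => by
      let C : Λ →ₗ[k] Matrix m n k := e.constr k c
      have hC (l l' : Λ) : C (l * l') = τ₀ l * C l' + C l * σ₀ l' := by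
        induction e_span l using Submodule.span_induction with
        | zero => simp
        | add x y _ _ hx hy =>
          simp only [add_mul, map_add, hx, hy, Matrix.add_mul]; abel
        | smul r x _ hx =>
          simp only [smul_mul_assoc, map_smul, hx, Matrix.smul_mul, smul_add]
        | mem x hx =>
          obtain ⟨a, rfl⟩ := hx
          induction e_span l' using Submodule.span_induction with
          | zero => simp
          | add x y _ _ hx hy =>
            simp only [mul_add, map_add, hx, hy, Matrix.mul_add]; abel
          | smul r x _ hx =>
            simp only [mul_smul_comm, map_smul, hx, Matrix.mul_smul, smul_add]
          | mem x hx =>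
            obtain ⟨b, rfl⟩ := hx
            have h1 := congrFun (congrFun hc a) b
            have h2 : C (e a * e b) = ∑ d, e.repr (e a * e b) d • c d := by
              conv_lhs => rw [← e.sum_repr (e a * e b)]
              simp [C]
            rw [h2, ← sub_eq_zero, ← sub_sub]
            simpa [C, g₀] using h1
      obtain ⟨h, hh⟩ := hder C hC
      exact ⟨h, by ext1 a; simpa [C, f₀] using (hh (e a)).symm⟩)
    H₀ (by ext1 a; simp [f₀, hH₀])
  refine ⟨H, hH, fun l => ?_⟩
  induction e_span l using Submodule.span_induction with
  | zero => simp
  | add x y _ _ hx hy => simp only [map_add, hx, hy, Matrix.mul_add, Matrix.add_mul]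
  | smul r x _ hx => simp only [map_smul, hx, Matrix.mul_smul, Matrix.smul_mul]
  | mem x hx =>
    obtain ⟨a, rfl⟩ := hx
    exact sub_eq_zero.1 (congrFun hfH a)

end Intertwiners

/-! ### Lifting endomorphisms of `V` -/

section Commutant

variable {k Λ V : Type u} [Field k] [Ring Λ] [Algebra k Λ] [AddCommGroup V] [Module k V]
  [Module Λ V] [IsScalarTower k Λ V]

/-- The matrix representation of `Λ` on a module `V` with a chosen `k`-basis. -/
noncomputable def matrixRep {n : Type*} [Fintype n] [DecidableEq n] (b : Module.Basis n k V) :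
    Λ →ₐ[k] Matrix n n k :=
  (LinearMap.toMatrixAlgEquiv b).toAlgHom.comp (Algebra.lsmul k k V)

theorem matrixRep_apply {n : Type*} [Fintype n] [DecidableEq n] (b : Module.Basis n k V) (l : Λ) :
    matrixRep b l = LinearMap.toMatrix b b (Algebra.lsmul k k V l) := rfl

theorem matrixRep_mulVec_repr {n : Type*} [Fintype n] [DecidableEq n] (b : Module.Basis n k V)
    (l : Λ) (v : V) : (matrixRep b l).mulVec (b.repr v) = b.repr (l • v) :=
  LinearMap.toMatrix_mulVec_repr b b (Algebra.lsmul k k V l) v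

variable (Λ V) in
/-- The additive group `Λ ⊕ V`, which carries the extension of `V` by `Λ` attached to a
derivation. -/
def ExtensionSpace : Type u := Λ × V

namespace ExtensionSpace

instance : AddCommGroup (ExtensionSpace Λ V) := inferInstanceAs (AddCommGroup (Λ × V))

/-- The extension of `V` by `Λ` attached to a derivation `c : Λ → Hom_k(V, Λ)`, on which `l ∈ Λ`
acts by `(x, v) ↦ (l x + c(l) v, l v)`. -/
abbrev module (c : Λ →ₗ[k] V →ₗ[k] Λ)
    (hc : ∀ l l' v, c (l * l') v = l * c l' v + c l (l' • v)) :
    Module Λ (ExtensionSpace Λ V) where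
  smul l x := (l * x.1 + c l x.2, l • x.2)
  one_smul x := by
    have h (v : V) : c 1 v = 0 := by simpa using hc 1 1 v
    exact Prod.ext (by change 1 * x.1 + c 1 x.2 = x.1; rw [h, one_mul, add_zero])
      (one_smul Λ x.2)
  mul_smul l l' x := Prod.ext (by
    change l * l' * x.1 + c (l * l') x.2 = l * (l' * x.1 + c l' x.2) + c l (l' • x.2)
    rw [hc, mul_add, mul_assoc, add_assoc]) (mul_smul l l' x.2)
  smul_zero l := Prod.ext (by
    change l * 0 + c l 0 = 0
    rw [mul_zero, map_zero, add_zero]) (smul_zero l)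
  zero_smul x := Prod.ext (by
    change 0 * x.1 + c 0 x.2 = 0
    rw [zero_mul, map_zero, LinearMap.zero_apply, add_zero]) (zero_smul Λ x.2)
  smul_add l x y := Prod.ext (by
    change l * (x.1 + y.1) + c l (x.2 + y.2) = l * x.1 + c l x.2 + (l * y.1 + c l y.2)
    rw [mul_add, map_add]; abel) (smul_add l x.2 y.2)
  add_smul l l' x := Prod.ext (by
    change (l + l') * x.1 + c (l + l') x.2 = l * x.1 + c l x.2 + (l' * x.1 + c l' x.2)
    rw [add_mul, map_add, LinearMap.add_apply]; abel) (add_smul l l' x.2)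

end ExtensionSpace

/-- If `Ext¹(V, Λ) = 0` then derivations `Λ → Hom_k(V, Λ)` are inner: the extension attached to
the derivation splits. -/
theorem ExtOneVanishes.derivation_inner (hV : ExtOneVanishes Λ V) (c : Λ →ₗ[k] V →ₗ[k] Λ)
    (hc : ∀ l l' v, c (l * l') v = l * c l' v + c l (l' • v)) :
    ∃ h : V →ₗ[k] Λ, ∀ l v, c l v = l * h v - h (l • v) := by
  let _ := ExtensionSpace.module c hc
  let π : ExtensionSpace Λ V →ₗ[Λ] V :=
    { toFun x := x.2
      map_add' _ _ := rfl
      map_smul' _ _ := rfl }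
  let f : LinearMap.ker π →ₗ[Λ] Λ :=
    { toFun x := x.1.1
      map_add' _ _ := rfl
      map_smul' l x := by
        have hx : x.1.2 = 0 := x.2
        change l * x.1.1 + c l x.1.2 = l * x.1.1
        rw [hx, map_zero, add_zero] }
  let mk (x : Λ) (v : V) : ExtensionSpace Λ V := (x, v)
  have mk_add (x y : Λ) (v w : V) : mk (x + y) (v + w) = mk x v + mk y w := rfl
  have smul_mk (l : Λ) (v : V) : l • mk 0 v = mk (c l v) 0 + mk 0 (l • v) := by
    rw [← mk_add, add_zero, zero_add]
    refine Prod.ext ?_ rfl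
    change l * 0 + c l v = c l v
    rw [mul_zero, zero_add]
  obtain ⟨g, hg⟩ := hV _ π (fun v => ⟨mk 0 v, rfl⟩) f
  have hg' (x : Λ) : g (mk x 0) = x := hg ⟨mk x 0, rfl⟩
  have hgs (l : Λ) (v : V) : l * g (mk 0 v) = c l v + g (mk 0 (l • v)) := by
    rw [← smul_eq_mul, ← map_smul, smul_mk, map_add, hg']
  have hc1 (v : V) : c 1 v = 0 := by simpa using hc 1 1 v
  refine ⟨⟨⟨fun v => g (mk 0 v), fun v w => ?_⟩, fun r v => ?_⟩, fun l v => ?_⟩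
  · rw [← map_add, ← mk_add, add_zero]
  · have := hgs (algebraMap k Λ r) v
    rw [Algebra.algebraMap_eq_smul_one, map_smul, LinearMap.smul_apply, hc1, smul_zero, zero_add,
      smul_assoc, one_smul, smul_mul_assoc, one_mul] at this
    exact this.symm
  · exact eq_sub_of_add_eq (hgs l v).symm

variable [Module.Finite k Λ] {S : Type*} [CommRing S] [Algebra k S] [IsLocalRing S]
  {n : Type*} [Fintype n] [DecidableEq n]

/-- Let `Ext¹(V, Λ) = 0` and let every endomorphism of `V` be a scalar up to maps factoring
through projectives. Then all endomorphisms of `V` lift to endomorphisms of each lift of `V`.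
A map through a projective, hence through a free module, is a sum of maps `v ↦ h(v) w` with
`h : V → Λ`, and `h` lifts since `Ext¹(V, Λ) = 0`. -/
theorem exists_commutant_lift [Module.Finite Λ V] (hExt : ExtOneVanishes Λ V)
    (hEnd : ∀ f : Module.End Λ V, ∃ c : k, FactorsThroughProjective (f - algebraMap k _ c))
    (b : Module.Basis n k V) (res : S →ₐ[k] k)
    (hres : ∀ s, res s = 0 → s ∈ IsLocalRing.maximalIdeal S)
    {σ : Λ →ₐ[k] Matrix n n S} (hσ : ∀ l, (σ l).map res = matrixRep b l)
    (a : Matrix n n k) (ha : ∀ l : Λ, matrixRep b l * a = a * matrixRep b l) :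
    ∃ A : Matrix n n S, A.map res = a ∧ ∀ l, σ l * A = A * σ l := by
  have hres' (c : k) : res (algebraMap k S c) = c := res.commutes c
  let e := Module.finBasis k Λ
  -- the trivial lift of the regular representation
  let τ : Λ →ₐ[k] Matrix _ _ S := (Algebra.ofId k S).mapMatrix.comp (matrixRep e)
  -- endomorphisms of the form `x ↦ h(x) w` lift, because `h` does
  have key (h : V →ₗ[Λ] Λ) (w : V) : ∃ A : Matrix n n S,
      A.map res = LinearMap.toMatrix b b (h.smulRight w |>.restrictScalars k) ∧
        ∀ l, σ l * A = A * σ l := by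
    obtain ⟨H, hH, hHσ⟩ := exists_intertwiner_lift res hres (τ := τ) (σ := σ)
      (τ₀ := matrixRep e) (σ₀ := matrixRep b) (fun l => by ext i j; simp [τ, Algebra.ofId_apply])
      hσ (fun c hc => by
        obtain ⟨h, hh⟩ := hExt.derivation_inner
          ((Matrix.toLin b e).toLinearMap ∘ₗ c) (fun l l' v => by
            have := congrArg (fun M => Matrix.toLin b e M v) (hc l l')
            simpa [Matrix.toLin_mul b e e, Matrix.toLin_mul b b e, matrixRep_apply] using this)
        refine ⟨LinearMap.toMatrix b e h, fun l => ?_⟩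
        apply (Matrix.toLin b e).injective
        ext v
        simpa [Matrix.toLin_mul b e e, Matrix.toLin_mul b b e, matrixRep_apply] using hh l v)
      (LinearMap.toMatrix b e (h.restrictScalars k)) (fun l => by
        rw [matrixRep_apply, matrixRep_apply, ← LinearMap.toMatrix_comp, ← LinearMap.toMatrix_comp]
        congr 1
        ext v
        simp)
    -- `W` is the matrix of `l ↦ l w'`, where `w'` lifts `w`
    let w' : n → S := fun i => algebraMap k S (b.repr w i)
    let W : Matrix n _ S := Matrix.of fun i a => (σ (e a)).mulVec w' i
    have hW (l : Λ) : σ l * W = W * τ l := by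
      ext i a
      have h1 : (σ (l * e a)).mulVec w' i = (σ l * W) i a := by
        rw [map_mul, ← Matrix.mulVec_mulVec]
        rfl
      have h2 : l * e a = ∑ d, matrixRep e l d a • e d := by
        conv_lhs => rw [← e.sum_repr (l * e a)]
        simp [matrixRep_apply, LinearMap.toMatrix_apply]
      rw [← h1, h2, map_sum, Matrix.sum_mulVec, Finset.sum_apply, Matrix.mul_apply]
      refine Finset.sum_congr rfl fun d _ => ?_
      rw [map_smul, Matrix.smul_mulVec]
      simp [W, τ, Algebra.ofId_apply, Algebra.smul_def, mul_comm]
    have hW' : W.map res = LinearMap.toMatrix e b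
        ((LinearMap.toSpanSingleton Λ V w).restrictScalars k) := by
      ext i a
      have h1 : (matrixRep b (e a)).mulVec (b.repr w) i = b.repr (e a • w) i := by
        rw [matrixRep_mulVec_repr]
      rw [LinearMap.toMatrix_apply]
      refine Eq.trans ?_ h1
      simp [W, w', Matrix.mulVec, dotProduct, ← hσ, hres']
    refine ⟨W * H, ?_, fun l => ?_⟩
    · have : (W * H).map res = W.map res * H.map res := Matrix.map_mul (f := (res : S →+* k))
      rw [this, hW', hH, ← LinearMap.toMatrix_comp]
      congr 1
    · rw [← Matrix.mul_assoc, hW, Matrix.mul_assoc, hHσ, Matrix.mul_assoc]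
  let f : Module.End Λ V :=
    { toFun := Matrix.toLin b b a
      map_add' := map_add _
      map_smul' := fun l v => by
        have := congrArg (fun M => Matrix.toLin b b M v) (ha l)
        simpa [Matrix.toLin_mul b b b, matrixRep_apply] using this.symm }
  obtain ⟨c, Q, _, _, i, p, hQ, hf⟩ := hEnd f
  obtain ⟨N, q, hq⟩ := Module.Finite.exists_fin' Λ V
  obtain ⟨p', hp'⟩ := Module.projective_lifting_property q p hq
  choose A hA hAσ using fun j : Fin N =>
    key (LinearMap.proj j ∘ₗ p' ∘ₗ i) (q (Pi.single j 1))
  refine ⟨algebraMap k S c • 1 + ∑ j, A j, ?_, fun l => ?_⟩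
  · have h1 : (algebraMap k S c • 1 + ∑ j, A j).map res = c • 1 + ∑ j, (A j).map res := by
      ext x y
      simp [Matrix.sum_apply, Matrix.one_apply, apply_ite res]
    rw [h1]
    apply (Matrix.toLin b b).injective
    ext v
    have h2 : f v = c • v + p (i v) := by
      have := LinearMap.congr_fun hf v
      rw [LinearMap.sub_apply, Module.algebraMap_end_apply, sub_eq_iff_eq_add'] at this
      exact this
    have h3 : p (i v) = ∑ j, (p' (i v)) j • q (Pi.single j 1) := by
      have h4 : p (i v) = q (p' (i v)) := (LinearMap.congr_fun hp' (i v)).symm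
      rw [h4]
      conv_lhs => rw [← Finset.univ_sum_single (p' (i v))]
      rw [map_sum]
      refine Finset.sum_congr rfl fun j _ => ?_
      rw [← map_smul, ← Pi.single_smul', smul_eq_mul, mul_one]
    refine Eq.trans ?_ h2.symm
    simp [hA, h3]
  · simp [Matrix.mul_add, Matrix.add_mul, Matrix.mul_sum, Matrix.sum_mul, hAσ]

end Commutant

/-! ### Matrices over adically complete rings -/

section Entries

variable {T : Type*} [CommRing T] {m n : Type*}

/-- The matrices with all entries in the ideal `I`. -/
def matricesIn (n : Type*) (I : Ideal T) : Submodule T (Matrix n n T) where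
  carrier := {x | ∀ p q, x p q ∈ I}
  add_mem' hx hy p q := I.add_mem (hx p q) (hy p q)
  zero_mem' _ _ := I.zero_mem
  smul_mem' c _ hx p q := I.mul_mem_left c (hx p q)

theorem mul_mem_matricesIn [Fintype n] {I J : Ideal T} {x y : Matrix n n T}
    (hx : x ∈ matricesIn n I) (hy : y ∈ matricesIn n J) : x * y ∈ matricesIn n (I * J) := fun p q =>
  sum_mem fun r _ => Ideal.mul_mem_mul (hx p r) (hy r q)

theorem mul_mem_matricesIn_right [Fintype n] {I : Ideal T} {x : Matrix n n T}
    (hx : x ∈ matricesIn n I) (y : Matrix n n T) : x * y ∈ matricesIn n I := fun p _ =>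
  sum_mem fun r _ => I.mul_mem_right _ (hx p r)

theorem mul_mem_matricesIn_left [Fintype n] {I : Ideal T} (x : Matrix n n T) {y : Matrix n n T}
    (hy : y ∈ matricesIn n I) : x * y ∈ matricesIn n I := fun _ q =>
  sum_mem fun r _ => I.mul_mem_left _ (hy r q)

theorem matricesIn_mono {I J : Ideal T} (h : I ≤ J) : matricesIn n I ≤ matricesIn n J :=
  fun _ hx p q => h (hx p q)

theorem smul_mem_matricesIn {I J : Ideal T} {c : T} (hc : c ∈ I) {x : Matrix n n T}
    (hx : x ∈ matricesIn n J) : c • x ∈ matricesIn n (I * J) := fun p q =>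
  Ideal.mul_mem_mul hc (hx p q)

theorem eq_zero_of_forall_mem_pow {I : Ideal T} [IsHausdorff I T] {t : T}
    (h : ∀ j : ℕ, t ∈ I ^ (j + 1)) : t = 0 := by
  refine IsHausdorff.haus ‹_› t fun j => ?_
  rw [SModEq.zero, smul_eq_mul, Ideal.mul_top]
  exact Ideal.pow_le_pow_right j.le_succ (h j)

theorem eq_zero_of_forall_mem_matricesIn {I : Ideal T} [IsHausdorff I T] {x : Matrix n n T}
    (h : ∀ j : ℕ, x ∈ matricesIn n (I ^ (j + 1))) : x = 0 := by
  ext p q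
  exact eq_zero_of_forall_mem_pow fun j => h j p q

/-- A contraction for the `I`-adic topology on the tuples of matrices with entries in `I` has a
fixed point. -/
theorem exists_fixedPoint {I : Ideal T} [IsAdicComplete I T]
    (G : (m → Matrix n n T) → (m → Matrix n n T))
    (hG : ∀ z, (∀ a, z a ∈ matricesIn n I) → ∀ a, G z a ∈ matricesIn n I)
    (hG' : ∀ z z', (∀ a, z a ∈ matricesIn n I) → (∀ a, z' a ∈ matricesIn n I) → ∀ j : ℕ,
      (∀ a, z a - z' a ∈ matricesIn n (I ^ j)) → ∀ a, G z a - G z' a ∈ matricesIn n (I ^ (j + 1))) :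
    ∃ z, (∀ a, z a ∈ matricesIn n I) ∧ G z = z := by
  let z : ℕ → (m → Matrix n n T) := fun j => G^[j] 0
  have hz (j : ℕ) : z (j + 1) = G (z j) := Function.iterate_succ_apply' G j 0
  have hzI (j : ℕ) : ∀ a, z j a ∈ matricesIn n I := by
    induction j with
    | zero => exact fun a => zero_mem _
    | succ j ih => rw [hz]; exact hG _ ih
  have hstep (j : ℕ) : ∀ a, z j a - z (j + 1) a ∈ matricesIn n (I ^ j) := by
    induction j with
    | zero => intro a p q; rw [pow_zero, Ideal.one_eq_top]; trivial
    | succ j ih =>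
      rw [hz (j + 1)]
      nth_rw 1 [hz j]
      exact hG' _ _ (hzI _) (hzI _) j ih
  have hcauchy (i j : ℕ) (hij : i ≤ j) : ∀ a, z i a - z j a ∈ matricesIn n (I ^ i) := by
    induction j, hij using Nat.le_induction with
    | base => intro a; rw [sub_self]; exact zero_mem _
    | succ j hij ih =>
      intro a
      rw [← sub_add_sub_cancel _ (z j a)]
      exact add_mem (ih a) (matricesIn_mono (Ideal.pow_le_pow_right hij) (hstep j a))
  have hlim (a : m) (p q : n) : ∃ l : T, ∀ j, z j a p q - l ∈ I ^ j := by
    obtain ⟨l, hl⟩ := IsPrecomplete.prec (I := I) (M := T) inferInstance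
      (f := fun j => z j a p q) (fun {i j} hij => by
        rw [SModEq.sub_mem, smul_eq_mul, Ideal.mul_top]
        exact hcauchy i j hij a p q)
    refine ⟨l, fun j => ?_⟩
    have := hl j
    rwa [SModEq.sub_mem, smul_eq_mul, Ideal.mul_top] at this
  choose l hl using hlim
  let w : m → Matrix n n T := fun a => Matrix.of (l a)
  have hw (j : ℕ) (a : m) : z j a - w a ∈ matricesIn n (I ^ j) := fun p q => hl a p q j
  have hwI (a : m) : w a ∈ matricesIn n I := by
    have := hw 1 a
    rw [pow_one] at this
    simpa using sub_mem (hzI 1 a) this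
  refine ⟨w, hwI, ?_⟩
  ext1 a
  rw [← sub_eq_zero]
  refine eq_zero_of_forall_mem_matricesIn (I := I) fun j => ?_
  have h1 := hG' (z j) w (hzI j) hwI j (hw j) a
  rw [← hz] at h1
  rw [← sub_sub_sub_cancel_left (w a) (G w a) (z (j + 1) a)]
  exact sub_mem (hw (j + 1) a) h1

end Entries

/-! ### A slice to the conjugation action -/

section Slice

variable {k Λ : Type*} [Field k] [Ring Λ] [Algebra k Λ]
  {m n : Type*} [Fintype n] [DecidableEq n]

/-- The infinitesimal action of `x` on a representation `ρ`: the commutators of `x` with the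
values of `ρ` on a family of elements of `Λ`. -/
def bracket (T : Type*) [CommRing T] [Algebra k T] (ρ : Λ →ₐ[k] Matrix n n k) (e : m → Λ) :
    Matrix n n T →ₗ[T] (m → Matrix n n T) where
  toFun x a := x * (ρ (e a)).map (algebraMap k T) - (ρ (e a)).map (algebraMap k T) * x
  map_add' x y := by
    ext1 a
    simp only [Matrix.add_mul, Matrix.mul_add, Pi.add_apply]
    abel
  map_smul' c x := by
    ext1 a
    simp [smul_sub]

variable {T T' : Type*} [CommRing T] [Algebra k T] [CommRing T'] [Algebra k T']
  (ρ : Λ →ₐ[k] Matrix n n k) (e : m → Λ)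

theorem bracket_apply (x : Matrix n n T) (a : m) : bracket T ρ e x a =
    x * (ρ (e a)).map (algebraMap k T) - (ρ (e a)).map (algebraMap k T) * x := rfl

theorem bracket_algebraMap (x : Matrix n n k) : bracket T ρ e (x.map (algebraMap k T)) =
    fun a => (bracket k ρ e x a).map (algebraMap k T) := by
  ext1 a
  simp [bracket_apply, ← Matrix.map_mul, Matrix.map_sub]

theorem bracket_mem {ρ : Λ →ₐ[k] Matrix n n k} {e : m → Λ} {I : Ideal T} {x : Matrix n n T}
    (hx : x ∈ matricesIn n I) (a : m) :
    bracket T ρ e x a ∈ matricesIn n I :=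
  sub_mem (mul_mem_matricesIn_right hx _) (mul_mem_matricesIn_left _ hx)

variable [Fintype m] [DecidableEq m] (s : (m → Matrix n n k) →ₗ[k] Matrix n n k)

/-- The extension of scalars from `k` to `T` of a linear map
`(m → Matrix n n k) → Matrix n n k`. -/
def extendScalars (T : Type*) [CommRing T] [Algebra k T]
    (s : (m → Matrix n n k) →ₗ[k] Matrix n n k) : (m → Matrix n n T) →ₗ[T] Matrix n n T where
  toFun y := ∑ a, ∑ p, ∑ q,
    y a p q • (s (Pi.single a (Matrix.single p q 1))).map (algebraMap k T)
  map_add' x y := by simp only [Pi.add_apply, Matrix.add_apply, add_smul, Finset.sum_add_distrib]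
  map_smul' c y := by
    simp only [Pi.smul_apply, Matrix.smul_apply, smul_eq_mul, mul_smul, Finset.smul_sum,
      RingHom.id_apply]

theorem extendScalars_map (φ : T →ₐ[k] T') (y : m → Matrix n n T) :
    extendScalars T' s (fun a => (y a).map φ) = (extendScalars T s y).map φ := by
  ext i j
  simp [extendScalars, Matrix.sum_apply, map_sum]

theorem pi_matrix_eq_sum_single (y : m → Matrix n n T) : y = ∑ a, ∑ p, ∑ q,
    y a p q • (Pi.single a (Matrix.single p q 1) : m → Matrix n n T) := by
  conv_lhs => rw [← Finset.univ_sum_single y]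
  refine Finset.sum_congr rfl fun a _ => ?_
  conv_lhs => rw [Matrix.matrix_eq_sum_single (y a)]
  rw [← LinearMap.coe_single (R := T), map_sum]
  refine Finset.sum_congr rfl fun p _ => ?_
  rw [map_sum]
  refine Finset.sum_congr rfl fun q _ => ?_
  rw [← map_smul, Matrix.smul_single, smul_eq_mul, mul_one]

theorem extendScalars_self : extendScalars k s = s := by
  refine LinearMap.ext fun y => ?_
  have h := congrArg s (pi_matrix_eq_sum_single y)
  simp only [map_sum, map_smul] at h
  exact h.symm

theorem extendScalars_algebraMap (y : m → Matrix n n k) :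
    extendScalars T s (fun a => (y a).map (algebraMap k T)) = (s y).map (algebraMap k T) := by
  have := extendScalars_map s (Algebra.ofId k T) y
  rwa [extendScalars_self] at this

variable {ρ e s}

theorem extendScalars_bracket_extendScalars (h : s ∘ₗ bracket k ρ e ∘ₗ s = s)
    (y : m → Matrix n n T) :
    extendScalars T s (bracket T ρ e (extendScalars T s y)) = extendScalars T s y := by
  rw [pi_matrix_eq_sum_single y]
  simp only [map_sum, map_smul]
  refine Finset.sum_congr rfl fun a _ => Finset.sum_congr rfl fun p _ =>
    Finset.sum_congr rfl fun q _ => ?_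
  have h1 : (Pi.single a (Matrix.single p q 1) : m → Matrix n n T) = fun a' =>
      ((Pi.single a (Matrix.single p q 1) : m → Matrix n n k) a').map (algebraMap k T) := by
    ext1 a'
    obtain rfl | ha := eq_or_ne a' a
    · simp
    · simp [Pi.single_eq_of_ne ha]
  rw [h1, extendScalars_algebraMap, bracket_algebraMap, extendScalars_algebraMap]
  rw [show s (bracket k ρ e (s _)) = s _ from LinearMap.congr_fun h _]

theorem extendScalars_mem {I : Ideal T} {y : m → Matrix n n T} (hy : ∀ a, y a ∈ matricesIn n I) :
    extendScalars T s y ∈ matricesIn n I :=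
  sum_mem fun a _ => sum_mem fun p _ => sum_mem fun q _ => by
    simpa using smul_mem_matricesIn (J := ⊤) (hy a p q) (fun _ _ => trivial)

end Slice

section Transversality

open IsLocalRing

variable {k Λ : Type*} [Field k] [Ring Λ] [Algebra k Λ]
  {m n : Type*} [Fintype m] [Fintype n] [DecidableEq m] [DecidableEq n]
  {T : Type*} [CommRing T] [Algebra k T] [IsLocalRing T]
  {ρ : Λ →ₐ[k] Matrix n n k} {s : (m → Matrix n n k) →ₗ[k] Matrix n n k} (res : T →ₐ[k] k)

theorem map_eq_zero_iff_mem_matricesIn {n : Type*} (hres : ∀ t, res t = 0 ↔ t ∈ maximalIdeal T)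
    {x : Matrix n n T} : x.map res = 0 ↔ x ∈ matricesIn n (maximalIdeal T) := by
  rw [← Matrix.ext_iff]
  exact forall₂_congr fun p q => hres _

theorem sub_map_mem_matricesIn {n : Type*} (hres : ∀ t, res t = 0 ↔ t ∈ maximalIdeal T)
    {x : Matrix n n T} {x₀ : Matrix n n k} (hx : x.map res = x₀) :
    x - x₀.map (algebraMap k T) ∈ matricesIn n (maximalIdeal T) := by
  rw [← map_eq_zero_iff_mem_matricesIn res hres]
  ext p q
  have h1 : res (x p q) = x₀ p q := congrFun (congrFun hx p) q
  have h2 : res (algebraMap k T (x₀ p q)) = x₀ p q := res.commutes _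
  simp [h1, h2]

/-- Every lift of `ρ` over a complete local ring is conjugate, by a matrix congruent to `1`, to
one in the slice, that is, to a lift `τ` whose difference with `ρ` on the family `e` is in the
kernel of `s`. -/
theorem exists_conj_mem_slice [IsAdicComplete (maximalIdeal T) T] {e : m → Λ}
    (hres : ∀ t, res t = 0 ↔ t ∈ maximalIdeal T)
    (hs : s ∘ₗ bracket k ρ e ∘ₗ s = s) {σ : Λ →ₐ[k] Matrix n n T} (hσ : ∀ l, (σ l).map res = ρ l) :
    ∃ (τ : Λ →ₐ[k] Matrix n n T) (g : Matrix n n T), (∀ l, (τ l).map res = ρ l) ∧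
      extendScalars T s (fun a => τ (e a) - (ρ (e a)).map (algebraMap k T)) = 0 ∧
      g.map res = 1 ∧ ∀ l, g * σ l = τ l * g := by
  let I := maximalIdeal T
  let δ : m → Matrix n n T := fun a => σ (e a) - (ρ (e a)).map (algebraMap k T)
  have hδ (a : m) : δ a ∈ matricesIn n I := sub_map_mem_matricesIn res hres (hσ _)
  -- For `g = 1 + x` the equation `g σ g⁻¹ = ρ + δ'` reads `δ' = δ + [x, ρ] + z`, where
  -- `z = x δ - δ' x` has higher order; `s δ' = 0` holds when `x = -s (δ + z)`.
  let X (z : m → Matrix n n T) : Matrix n n T := -extendScalars T s (δ + z)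
  let Δ (z : m → Matrix n n T) : m → Matrix n n T := δ + bracket T ρ e (X z) + z
  let G (z : m → Matrix n n T) : m → Matrix n n T := fun a => X z * δ a - Δ z a * X z
  have hX {z : m → Matrix n n T} (hz : ∀ a, z a ∈ matricesIn n I) : X z ∈ matricesIn n I :=
    neg_mem (extendScalars_mem fun a => add_mem (hδ a) (hz a))
  have hΔ {z : m → Matrix n n T} (hz : ∀ a, z a ∈ matricesIn n I) (a : m) :
      Δ z a ∈ matricesIn n I :=
    add_mem (add_mem (hδ a) (bracket_mem (hX hz) a)) (hz a)
  have hXX {z z' : m → Matrix n n T} {j : ℕ}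
      (hz : ∀ a, z a - z' a ∈ matricesIn n (I ^ j)) : X z - X z' ∈ matricesIn n (I ^ j) := by
    have : X z - X z' = -extendScalars T s (z - z') := by
      simp only [X, map_add, map_sub]
      abel
    rw [this]
    exact neg_mem (extendScalars_mem hz)
  have hΔΔ {z z' : m → Matrix n n T} {j : ℕ}
      (hz : ∀ a, z a - z' a ∈ matricesIn n (I ^ j)) (a : m) :
      Δ z a - Δ z' a ∈ matricesIn n (I ^ j) := by
    have : Δ z a - Δ z' a = bracket T ρ e (X z - X z') a + (z a - z' a) := by
      simp only [Δ, map_sub, Pi.add_apply, Pi.sub_apply]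
      abel
    rw [this]
    exact add_mem (bracket_mem (hXX hz) a) (hz a)
  obtain ⟨z, hz, hGz⟩ := exists_fixedPoint (I := I) G
    (fun z hz a => sub_mem (mul_mem_matricesIn_right (hX hz) _)
      (mul_mem_matricesIn_left _ (hX hz)))
    (fun z z' hz hz' j hzz a => by
      have : G z a - G z' a = (X z - X z') * δ a - (Δ z a - Δ z' a) * X z -
          Δ z' a * (X z - X z') := by
        simp only [G, sub_mul, mul_sub]
        abel
      rw [this]
      refine sub_mem (sub_mem ?_ ?_) ?_
      · rw [pow_succ]; exact mul_mem_matricesIn (hXX hzz) (hδ a)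
      · rw [pow_succ]; exact mul_mem_matricesIn (hΔΔ hzz a) (hX hz)
      · rw [pow_succ']; exact mul_mem_matricesIn (hΔ hz' a) (hXX hzz))
  have hg : (1 + X z).map res = 1 := by
    have h1 := (map_eq_zero_iff_mem_matricesIn res hres).2 (hX hz)
    have h2 : (1 + X z).map res = 1 + (X z).map res := by
      ext p q
      simp [Matrix.one_apply, apply_ite res]
    rw [h2, h1, add_zero]
  have hunit : IsUnit (1 + X z) := by
    rw [Matrix.isUnit_iff_isUnit_det, ← isUnit_map_iff (residue T), isUnit_iff_ne_zero, ne_eq,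
      residue_eq_zero_iff, ← hres, AlgHom.map_det]
    change Matrix.det ((1 + X z).map res) ≠ 0
    rw [hg, Matrix.det_one]
    exact one_ne_zero
  obtain ⟨g, hgX⟩ := hunit
  let τ : Λ →ₐ[k] Matrix n n T :=
    { toFun l := g * σ l * (g⁻¹ : (Matrix n n T)ˣ)
      map_one' := by simp
      map_mul' l l' := by simp [mul_assoc]
      map_zero' := by simp
      map_add' l l' := by simp [mul_add, add_mul]
      commutes' c := by
        rw [AlgHom.commutes, ← Algebra.commutes c (g : Matrix n n T), mul_assoc, Units.mul_inv,
          mul_one] }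
  have hτ (l : Λ) : g * σ l = τ l * g := by simp [τ]
  have hτe (a : m) : τ (e a) = (ρ (e a)).map (algebraMap k T) + Δ z a := by
    refine g.isUnit.mul_right_cancel ?_
    rw [← hτ, hgX]
    have h1 : σ (e a) = (ρ (e a)).map (algebraMap k T) + δ a := by simp [δ]
    have h2 : Δ z a = δ a + (X z * (ρ (e a)).map (algebraMap k T) -
        (ρ (e a)).map (algebraMap k T) * X z) + z a := rfl
    have h3 : X z * δ a - Δ z a * X z = z a := congrFun hGz a
    have h4 : Δ z a * X z = X z * δ a - z a := by rw [← h3, sub_sub_cancel]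
    rw [mul_add, mul_one, add_mul, add_mul, h4, h2, h1]
    noncomm_ring
  refine ⟨τ, g, fun l => ?_, ?_, by rw [hgX, hg], hτ⟩
  · have h1 : ((g : Matrix n n T) * σ l).map res = (τ l * g).map res := by rw [hτ]
    have h2 : ((g : Matrix n n T) * σ l).map res = (g : Matrix n n T).map res * (σ l).map res :=
      Matrix.map_mul (f := (res : T →+* k))
    have h3 : (τ l * g).map res = (τ l).map res * (g : Matrix n n T).map res :=
      Matrix.map_mul (f := (res : T →+* k))
    rw [h2, h3, hgX, hg, one_mul, mul_one, hσ] at h1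
    exact h1.symm
  · have h1 : (fun a => τ (e a) - (ρ (e a)).map (algebraMap k T)) = Δ z := by
      ext1 a
      rw [hτe, add_sub_cancel_left]
    have h2 : extendScalars T s (bracket T ρ e (X z)) = X z := by
      simp only [X, map_neg]
      rw [extendScalars_bracket_extendScalars hs]
    rw [h1]
    simp only [Δ, map_add, h2]
    simp only [X, map_add]
    abel

/-- Two lifts of `ρ` in the slice which are conjugate by a matrix congruent to `1` are equal,
provided that the commutant of `ρ` lifts to the commutant of the first one. If `1 + x` is a
conjugating matrix with `x` of order `j`, then the slice condition makes `x` congruent, modulo terms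
of order `j + 1`, to a combination of matrices commuting with `ρ`; these lift to the commutant,
and dividing by the resulting element of the commutant improves the order of `x`. -/
theorem eq_of_conj_of_mem_slice [IsHausdorff (maximalIdeal T) T] (e : Module.Basis m k Λ)
    (hres : ∀ t, res t = 0 ↔ t ∈ maximalIdeal T)
    (hs : bracket k ρ e ∘ₗ s ∘ₗ bracket k ρ e = bracket k ρ e)
    {σ τ : Λ →ₐ[k] Matrix n n T} (hσ : ∀ l, (σ l).map res = ρ l) (hτ : ∀ l, (τ l).map res = ρ l)
    (hσs : extendScalars T s (fun a => σ (e a) - (ρ (e a)).map (algebraMap k T)) = 0)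
    (hτs : extendScalars T s (fun a => τ (e a) - (ρ (e a)).map (algebraMap k T)) = 0)
    (hcomm : ∀ a : Matrix n n k, (∀ l, ρ l * a = a * ρ l) →
      ∃ A : Matrix n n T, A.map res = a ∧ ∀ l, σ l * A = A * σ l)
    (g : Matrix n n T) (hg : g.map res = 1) (hgσ : ∀ l, g * σ l = τ l * g) : σ = τ := by
  let I := maximalIdeal T
  -- the projections of the matrix units to the commutant of `ρ`, along the image of `s`
  let E (p q : n) : Matrix n n k :=
    Matrix.single p q 1 - s (bracket k ρ e (Matrix.single p q 1))
  have hE (p q : n) (l : Λ) : ρ l * E p q = E p q * ρ l := by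
    have h1 : bracket k ρ e (E p q) = 0 := by
      have := LinearMap.congr_fun hs (Matrix.single p q 1)
      simp only [LinearMap.comp_apply] at this
      rw [map_sub, this, sub_self]
    have h2 (x : Matrix n n k) : x.map (algebraMap k k) = x := by ext; rfl
    have h3 (a : m) : ρ (e a) * E p q = E p q * ρ (e a) := by
      have := congrFun h1 a
      rw [bracket_apply, h2] at this
      exact (sub_eq_zero.1 this).symm
    have hl : l ∈ Submodule.span k (Set.range e) := e.span_eq ▸ Submodule.mem_top
    induction hl using Submodule.span_induction with
    | zero => simp
    | add x y _ _ hx hy => simp only [map_add, hx, hy, mul_add, add_mul]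
    | smul r x _ hx => simp only [map_smul, hx, mul_smul_comm, smul_mul_assoc]
    | mem x hx =>
      obtain ⟨a, rfl⟩ := hx
      exact h3 a
  choose A hA hAσ using fun p q => hcomm (E p q) (hE p q)
  have hmain (j : ℕ) : ∃ x ∈ matricesIn n (I ^ (j + 1)), ∀ l, (1 + x) * σ l = τ l * (1 + x) := by
    induction j with
    | zero =>
      refine ⟨g - 1, ?_, by simpa using hgσ⟩
      have h1 : (1 : Matrix n n k).map (algebraMap k T) = 1 := by simp
      have := sub_map_mem_matricesIn res hres hg
      rw [h1] at this
      simpa using this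
    | succ j ih =>
      obtain ⟨x, hx, hxσ⟩ := ih
      have h1 : extendScalars T s (bracket T ρ e x) ∈ matricesIn n (I ^ (j + 1 + 1)) := by
        -- `[x, ρ]` is the difference of two elements of the slice, up to terms of higher order
        have h2 : bracket T ρ e x = (fun a => τ (e a) - (ρ (e a)).map (algebraMap k T)) -
            (fun a => σ (e a) - (ρ (e a)).map (algebraMap k T)) -
            (fun a => x * (σ (e a) - (ρ (e a)).map (algebraMap k T)) -
              (τ (e a) - (ρ (e a)).map (algebraMap k T)) * x) := by
          ext1 a
          have h3 := hxσ (e a)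
          rw [add_mul, mul_add, one_mul, mul_one] at h3
          have h4 : x * σ (e a) = τ (e a) + τ (e a) * x - σ (e a) := by rw [← h3]; abel
          simp only [bracket_apply, Pi.sub_apply, mul_sub, sub_mul, h4]
          abel
        rw [h2, map_sub, map_sub, hσs, hτs, sub_zero, zero_sub]
        refine neg_mem (extendScalars_mem fun a => sub_mem ?_ ?_)
        · rw [pow_succ _ (j + 1)]
          exact mul_mem_matricesIn hx (sub_map_mem_matricesIn res hres (hσ _))
        · rw [pow_succ' _ (j + 1)]
          exact mul_mem_matricesIn (sub_map_mem_matricesIn res hres (hτ _)) hx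
      let y : Matrix n n T := ∑ p, ∑ q, x p q • A p q
      have hyσ (l : Λ) : σ l * y = y * σ l := by
        simp [y, Finset.mul_sum, Finset.sum_mul, hAσ]
      have hy : y - (x - extendScalars T s (bracket T ρ e x)) ∈ matricesIn n (I ^ (j + 1 + 1)) := by
        have h2 : x - extendScalars T s (bracket T ρ e x) =
            ∑ p, ∑ q, x p q • (E p q).map (algebraMap k T) := by
          have h3 : x = ∑ p, ∑ q, x p q • (Matrix.single p q 1 : Matrix n n k).map
              (algebraMap k T) := by
            conv_lhs => rw [Matrix.matrix_eq_sum_single x]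
            simp
          conv_lhs => rw [h3]
          simp only [map_sum, map_smul, ← Finset.sum_sub_distrib, ← smul_sub]
          refine Finset.sum_congr rfl fun p _ => Finset.sum_congr rfl fun q _ => ?_
          rw [bracket_algebraMap, extendScalars_algebraMap, ← Matrix.map_sub]
          exact map_sub _
        rw [h2]
        simp only [y, ← Finset.sum_sub_distrib, ← smul_sub]
        refine sum_mem fun p _ => sum_mem fun q _ => ?_
        rw [pow_succ _ (j + 1)]
        exact smul_mem_matricesIn (hx p q) (sub_map_mem_matricesIn res hres (hA p q))
      have hyI : y ∈ matricesIn n (I ^ (j + 1)) :=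
        sum_mem fun p _ => sum_mem fun q _ => by
          simpa using smul_mem_matricesIn (J := ⊤) (hx p q) (fun _ _ => trivial)
      refine ⟨x - y - x * y, ?_, fun l => ?_⟩
      · refine sub_mem ?_ ?_
        · have := sub_mem h1 hy
          convert this using 1
          abel
        · refine matricesIn_mono ?_ (mul_mem_matricesIn hx hyI)
          rw [← pow_add]
          exact Ideal.pow_le_pow_right (by omega)
      · have h2 : 1 + (x - y - x * y) = (1 + x) * (1 - y) := by noncomm_ring
        rw [h2, mul_assoc, sub_mul, one_mul, ← hyσ, ← mul_assoc (τ l), ← hxσ]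
        noncomm_ring
  ext1 l
  rw [← sub_eq_zero]
  refine eq_zero_of_forall_mem_matricesIn (I := I) fun j => ?_
  obtain ⟨x, hx, hxσ⟩ := hmain j
  have h1 : σ l - τ l = τ l * x - x * σ l := by
    have := hxσ l
    rw [add_mul, mul_add, one_mul, mul_one] at this
    rw [sub_eq_sub_iff_add_eq_add, this, add_comm]
  rw [h1]
  exact sub_mem (mul_mem_matricesIn_left _ hx) (mul_mem_matricesIn_right hx _)

end Transversality

/-! ### Quotients of power series rings -/

section CompleteRings

open IsLocalRing

variable {k : Type u} [Field k]

namespace CHat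

/-- The residue field of a local `k`-algebra with an augmentation to `k` is `k`. -/
theorem bijective_algebraMap_residueField {A : Type*} [CommRing A] [IsLocalRing A] [Algebra k A]
    (res : A →ₐ[k] k) (hres : ∀ a, res a = 0 → a ∈ maximalIdeal A) :
    Function.Bijective (algebraMap k (ResidueField A)) := by
  refine ⟨(algebraMap k _).injective, fun y => ?_⟩
  obtain ⟨x, rfl⟩ := residue_surjective y
  refine ⟨res x, ?_⟩
  rw [IsScalarTower.algebraMap_apply k A (ResidueField A), ResidueField.algebraMap_eq,
    ← sub_eq_zero, ← map_sub, IsLocalRing.residue_eq_zero_iff]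
  exact hres _ (by simp)

theorem exists_algebraMap_add (R : CHat k) (r : R) :
    ∃ t ∈ maximalIdeal R, r = algebraMap k R (R.residue r) + t :=
  ⟨r - algebraMap k R (R.residue r), by rw [← residue_eq_zero_iff]; simp, by simp⟩

theorem residue_unique (R : CHat k) (φ : R →ₐ[k] k) : φ = R.residue := by
  have h (t : R) (ht : t ∈ maximalIdeal R) : φ t = 0 := by
    by_contra h0
    have h1 : φ (t - algebraMap k R (φ t)) = 0 := by simp
    have h2 : IsUnit (algebraMap k R (φ t)) := (IsUnit.mk0 _ h0).map _
    have h3 : IsUnit (t - algebraMap k R (φ t)) := by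
      by_contra h4
      exact (mem_maximalIdeal _).1 (by simpa using sub_mem ht ((mem_maximalIdeal _).2 h4)) h2
    exact (h3.map φ).ne_zero h1
  ext r
  obtain ⟨t, ht, hr⟩ := R.exists_algebraMap_add r
  conv_lhs => rw [hr]
  simp [h t ht]

/-- All `k`-algebra homomorphisms are morphisms of the category. -/
def homOfAlgHom {R S : CHat k} (φ : R →ₐ[k] S) : R ⟶ S := ⟨φ, R.residue_unique _⟩

theorem Hom.map_mem {R S : CHat k} (f : R ⟶ S) {r : R} (hr : r ∈ maximalIdeal R) :
    f.toAlgHom r ∈ maximalIdeal S := by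
  have := f.map_pow_le 1 (Ideal.mem_map_of_mem f.toAlgHom (by simpa using hr))
  simpa using this

/-- Morphisms are determined by their values on generators of the maximal ideal. -/
theorem hom_ext_of_span {R S : CHat k} {ι : Type*} (x : ι → R)
    (hx : maximalIdeal R = Ideal.span (Set.range x)) {f g : R ⟶ S}
    (h : ∀ i, f.toAlgHom (x i) = g.toAlgHom (x i)) : f = g := by
  -- `r = c + t` with `c ∈ k` and `t ∈ m`, and `f t - g t` gains one order over `f - g`
  have key (j : ℕ) : ∀ r : R, f.toAlgHom r - g.toAlgHom r ∈ maximalIdeal S ^ j := by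
    induction j with
    | zero => intro r; simp
    | succ j ih =>
      have hspan (t : R) (ht : t ∈ maximalIdeal R) :
          f.toAlgHom t - g.toAlgHom t ∈ maximalIdeal S ^ (j + 1) := by
        rw [hx] at ht
        induction ht using Submodule.span_induction with
        | zero => simp
        | add t t' _ _ ht ht' =>
          rw [map_add, map_add, add_sub_add_comm]
          exact add_mem ht ht'
        | mem t ht =>
          obtain ⟨i, rfl⟩ := ht
          rw [h, sub_self]
          exact zero_mem _
        | smul r t ht0 ht =>
          have h1 : f.toAlgHom (r • t) - g.toAlgHom (r • t) =
              (f.toAlgHom r - g.toAlgHom r) * f.toAlgHom t +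
                g.toAlgHom r * (f.toAlgHom t - g.toAlgHom t) := by
            rw [smul_eq_mul, map_mul, map_mul]
            ring
          rw [h1]
          refine add_mem ?_ (Ideal.mul_mem_left _ _ ht)
          rw [pow_succ]
          exact Ideal.mul_mem_mul (ih r) (f.map_mem (hx.ge ht0))
      intro r
      obtain ⟨t, ht, hr⟩ := R.exists_algebraMap_add r
      rw [hr, map_add, map_add, AlgHom.commutes, AlgHom.commutes, add_sub_add_left_eq_sub]
      exact hspan t ht
  refine Hom.ext (AlgHom.ext fun r => ?_)
  rw [← sub_eq_zero]
  exact eq_zero_of_forall_mem_pow (I := maximalIdeal S) fun j => key (j + 1) r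

/-- The quotient of a complete local Noetherian `k`-algebra by a proper ideal. -/
noncomputable def quotient (R : CHat k) (I : Ideal R) (hI : I ≤ maximalIdeal R) : CHat k :=
  have : Nontrivial (R ⧸ I) := Ideal.Quotient.nontrivial_iff.2 fun h =>
    (maximalIdeal.isMaximal R).ne_top (top_le_iff.1 (h ▸ hI))
  have hlocal : IsLocalRing (R ⧸ I) :=
    .of_surjective' (Ideal.Quotient.mk I) Ideal.Quotient.mk_surjective
  have hmap : (maximalIdeal R).map (algebraMap R (R ⧸ I)) = maximalIdeal (R ⧸ I) :=
    map_maximalIdeal_of_surjective (Ideal.Quotient.mk I) Ideal.Quotient.mk_surjective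
  { carrier := R ⧸ I
    isAdicComplete :=
      { toIsPrecomplete := by
          rw [← hmap, IsPrecomplete.map_algebraMap_iff, ← AdicCompletion.of_surjective_iff]
          intro y
          obtain ⟨x, rfl⟩ := AdicCompletion.map_surjective (maximalIdeal R)
            (f := (Algebra.linearMap R (R ⧸ I))) Ideal.Quotient.mk_surjective y
          obtain ⟨r, rfl⟩ := AdicCompletion.of_surjective (maximalIdeal R) R x
          exact ⟨algebraMap R (R ⧸ I) r,
            (AdicCompletion.map_of (maximalIdeal R) (Algebra.linearMap R (R ⧸ I)) r).symm⟩ }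
    bijective_residue := bijective_algebraMap_residueField
      (Ideal.Quotient.liftₐ I R.residue fun a ha => (R.residue_eq_zero_iff a).2 (hI ha)) fun a => by
        obtain ⟨a, rfl⟩ := Ideal.Quotient.mk_surjective a
        intro h
        rw [← hmap]
        exact Ideal.mem_map_of_mem _ ((R.residue_eq_zero_iff a).1 h) }

section PowerSeries

variable {σ : Type} [Finite σ]

theorem maximalIdeal_mvPowerSeries :
    maximalIdeal (MvPowerSeries σ k) = Ideal.span (Set.range MvPowerSeries.X) := by
  refine le_antisymm (fun p hp => ?_) ?_
  · have h0 : MvPowerSeries.constantCoeff p = 0 := by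
      by_contra h
      exact (mem_maximalIdeal _).1 hp (MvPowerSeries.isUnit_iff_constantCoeff.2 (IsUnit.mk0 _ h))
    let e := MvPowerSeries.toAdicCompletionAlgEquiv σ k
    have h1 : e p ∈ (MvPolynomial.idealOfVars σ k).map (algebraMap _ (AdicCompletion _ _)) := by
      rw [← AdicCompletion.ker_evalOneₐ_eq_map _ (MvPolynomial.idealOfVars_fg σ k)]
      change AdicCompletion.evalOneₐ _ (MvPowerSeries.toAdicCompletion σ k p) = 0
      rw [MvPowerSeries.toAdicCompletion, AdicCompletion.evalOneₐ_liftAlgHom]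
      · refine Ideal.Quotient.eq_zero_iff_mem.2 ?_
        rw [← pow_one (MvPolynomial.idealOfVars σ k), MvPolynomial.mem_pow_idealOfVars_iff']
        intro x hx
        rw [MvPowerSeries.coeff_truncTotal _ hx, (Finsupp.degree_eq_zero_iff x).1 (by omega)]
        exact h0
      · intro i j hij
        refine AlgHom.ext fun q => Ideal.Quotient.eq.2 ?_
        exact MvPowerSeries.truncTotal_sub_truncTotal_mem_pow_idealOfVars hij le_rfl q
    have h2 : (MvPolynomial.idealOfVars σ k).map (algebraMap (MvPolynomial σ k)
        (AdicCompletion (MvPolynomial.idealOfVars σ k) (MvPolynomial σ k))) ≤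
        (Ideal.span (Set.range MvPowerSeries.X)).comap e.symm := by
      rw [Ideal.map_le_iff_le_comap, Ideal.span_le]
      rintro _ ⟨i, rfl⟩
      have h3 : e.symm (algebraMap (MvPolynomial σ k) _ (MvPolynomial.X i)) =
          MvPowerSeries.X i := by
        rw [AlgEquiv.commutes]
        exact MvPolynomial.coe_X i
      refine Ideal.subset_span ⟨i, h3.symm⟩
    simpa using h2 h1
  · rw [Ideal.span_le]
    rintro _ ⟨i, rfl⟩
    exact (mem_maximalIdeal _).2 fun h => by simpa using MvPowerSeries.isUnit_iff_constantCoeff.1 h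

theorem aeval_mem_pow {σ S : Type*} [CommRing S] [Algebra k S] {I : Ideal S} {x : σ → S}
    (hx : ∀ i, x i ∈ I) {n : ℕ} {p : MvPolynomial σ k} (hp : p ∈ MvPolynomial.idealOfVars σ k ^ n) :
    MvPolynomial.aeval x p ∈ I ^ n := by
  have h : (MvPolynomial.idealOfVars σ k).map (MvPolynomial.aeval (R := k) x) ≤ I := by
    rw [Ideal.map_span, Ideal.span_le]
    rintro _ ⟨_, ⟨i, rfl⟩, rfl⟩
    simpa using hx i
  have := Ideal.mem_map_of_mem (MvPolynomial.aeval (R := k) x) hp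
  rw [Ideal.map_pow] at this
  exact Ideal.pow_right_mono h n this

/-- The evaluation of power series at a point with coordinates in `I`, modulo `I ^ n`. -/
noncomputable def evalModPow {S : Type*} [CommRing S] [Algebra k S] {I : Ideal S} {x : σ → S}
    (hx : ∀ i, x i ∈ I) (n : ℕ) : MvPowerSeries σ k →ₐ[k] S ⧸ I ^ n :=
  (Ideal.Quotient.liftₐ (MvPolynomial.idealOfVars σ k ^ n)
    ((Ideal.Quotient.mkₐ k (I ^ n)).comp (MvPolynomial.aeval x))
    fun _ hp => Ideal.Quotient.eq_zero_iff_mem.2 (aeval_mem_pow hx hp)).comp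
      ((MvPowerSeries.truncTotalAlgHom σ k n).restrictScalars k)

theorem evalModPow_apply {S : Type*} [CommRing S] [Algebra k S] {I : Ideal S} {x : σ → S}
    (hx : ∀ i, x i ∈ I) (n : ℕ) (p : MvPowerSeries σ k) :
    evalModPow hx n p = Ideal.Quotient.mk _ (MvPolynomial.aeval x (p.truncTotal n)) := rfl

/-- Power series can be evaluated at points with coordinates in `I`, for `I`-adically complete
target rings. -/
theorem exists_hom_powerSeries {S : Type*} [CommRing S] [Algebra k S] {I : Ideal S}
    [IsAdicComplete I S] {x : σ → S} (hx : ∀ i, x i ∈ I) :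
    ∃ f : MvPowerSeries σ k →ₐ[k] S, ∀ i, f (MvPowerSeries.X i) = x i := by
  refine ⟨IsAdicComplete.liftAlgHom I (evalModPow hx) ?_, fun i => ?_⟩
  · intro m n h
    refine AlgHom.ext fun p => ?_
    change Ideal.Quotient.mk (I ^ m) (MvPolynomial.aeval x (p.truncTotal n)) =
      Ideal.Quotient.mk (I ^ m) (MvPolynomial.aeval x (p.truncTotal m))
    rw [Ideal.Quotient.eq, ← map_sub]
    exact aeval_mem_pow hx (MvPowerSeries.truncTotal_sub_truncTotal_mem_pow_idealOfVars h le_rfl p)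
  · rw [← sub_eq_zero]
    refine eq_zero_of_forall_mem_pow (I := I) fun n => ?_
    rw [← Ideal.Quotient.eq, IsAdicComplete.mk_liftAlgHom, evalModPow_apply, Ideal.Quotient.eq,
      ← MvPolynomial.aeval_X (R := k) x i, ← map_sub]
    refine aeval_mem_pow hx ?_
    rw [MvPolynomial.mem_pow_idealOfVars_iff']
    intro d hd
    rw [MvPolynomial.coeff_sub, MvPowerSeries.coeff_truncTotal _ hd, ← MvPolynomial.coe_X,
      MvPolynomial.coeff_coe, sub_self]

variable (k σ) in
/-- The ring of formal power series in finitely many variables over `k`. -/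
noncomputable def powerSeries : CHat k where
  carrier := MvPowerSeries σ k
  isNoetherianRing := MvPowerSeries.isNoetherianRing k
  isAdicComplete := by rw [maximalIdeal_mvPowerSeries]; infer_instance
  bijective_residue := bijective_algebraMap_residueField
    (A := MvPowerSeries σ k)
    { MvPowerSeries.constantCoeff with
      commutes' := fun c => MvPowerSeries.constantCoeff_C c } fun p hp => by
        rw [mem_maximalIdeal, mem_nonunits_iff, MvPowerSeries.isUnit_iff_constantCoeff,
          show MvPowerSeries.constantCoeff p = 0 from hp]
        exact not_isUnit_zero

end PowerSeries

end CHat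

end CompleteRings

/-! ### The universal lift in the slice -/

section UniversalSlice

open IsLocalRing

variable {k Λ : Type u} [Field k] [Ring Λ] [Algebra k Λ]
  {m n : Type} [Fintype m] [Fintype n] [DecidableEq n]

/-- The linear map `Λ → Matrix n n T` which differs from `ρ` on the basis `e` by the matrices with
entries `x`. -/
noncomputable def pointMap {T : Type*} [CommRing T] [Algebra k T] (ρ : Λ →ₐ[k] Matrix n n k)
    (e : Module.Basis m k Λ) (x : m × n × n → T) : Λ →ₗ[k] Matrix n n T where
  toFun l := (ρ l).map (algebraMap k T) + ∑ a, e.repr l a • Matrix.of fun i j => x (a, i, j)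
  map_add' l l' := by
    simp only [map_add, Finsupp.add_apply, add_smul, Finset.sum_add_distrib,
      Matrix.map_add (algebraMap k T) (map_add _)]
    abel
  map_smul' c l := by
    rw [RingHom.id_apply, smul_add, Finset.smul_sum]
    congr 1
    · ext i j
      rw [map_smul]
      simp only [Matrix.map_apply, Matrix.smul_apply, smul_eq_mul, map_mul]
      exact (Algebra.smul_def _ _).symm
    · simp only [map_smul, Finsupp.smul_apply, smul_eq_mul, mul_smul]

variable {T T' : Type*} [CommRing T] [Algebra k T] [CommRing T'] [Algebra k T']
  {ρ : Λ →ₐ[k] Matrix n n k} {e : Module.Basis m k Λ}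

theorem pointMap_basis (x : m × n × n → T) (a : m) : pointMap ρ e x (e a) =
    (ρ (e a)).map (algebraMap k T) + Matrix.of fun i j => x (a, i, j) := by
  change _ + ∑ b, e.repr (e a) b • Matrix.of (fun i j => x (b, i, j)) = _
  classical
  rw [Finset.sum_eq_single a]
  · simp
  · intro b _ hb
    simp [hb.symm]
  · simp

theorem pointMap_map (φ : T →ₐ[k] T') (x : m × n × n → T) (l : Λ) :
    (pointMap ρ e x l).map φ = pointMap ρ e (φ ∘ x) l := by
  ext i j
  simp [pointMap, Matrix.sum_apply]

theorem pointMap_entries (τ : Λ →ₐ[k] Matrix n n T) (l : Λ) :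
    pointMap ρ e (fun i => (τ (e i.1) - (ρ (e i.1)).map (algebraMap k T)) i.2.1 i.2.2) l = τ l := by
  have : pointMap ρ e (fun i => (τ (e i.1) - (ρ (e i.1)).map (algebraMap k T)) i.2.1 i.2.2) =
      τ.toLinearMap := e.ext fun a => by
    rw [pointMap_basis]
    ext i j
    simp
  exact LinearMap.congr_fun this l

variable [DecidableEq m]

/-- The equations for the point `x` to define an algebra homomorphism which lies in the slice. -/
def relations (ρ : Λ →ₐ[k] Matrix n n k) (e : Module.Basis m k Λ)
    (s : (m → Matrix n n k) →ₗ[k] Matrix n n k) (x : m × n × n → T) : Set T :=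
  {r | ∃ i j, (∃ l l', r = (pointMap ρ e x (l * l') - pointMap ρ e x l * pointMap ρ e x l') i j) ∨
    r = (pointMap ρ e x 1 - 1) i j ∨
    r = extendScalars T s (fun a => Matrix.of fun i j => x (a, i, j)) i j}

variable {s : (m → Matrix n n k) →ₗ[k] Matrix n n k}

theorem relations_eq_zero_iff {x : m × n × n → T} : (∀ r ∈ relations ρ e s x, r = 0) ↔
    (∀ l l', pointMap ρ e x (l * l') = pointMap ρ e x l * pointMap ρ e x l') ∧
      pointMap ρ e x 1 = 1 ∧ extendScalars T s (fun a => Matrix.of fun i j => x (a, i, j)) = 0 := by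
  constructor
  · refine fun h => ⟨fun l l' => sub_eq_zero.1 ?_, sub_eq_zero.1 ?_, ?_⟩
    · ext i j
      exact h _ ⟨i, j, .inl ⟨l, l', rfl⟩⟩
    · ext i j
      exact h _ ⟨i, j, .inr (.inl rfl)⟩
    · ext i j
      exact h _ ⟨i, j, .inr (.inr rfl)⟩
  · rintro ⟨h1, h2, h3⟩ r ⟨i, j, ⟨l, l', rfl⟩ | rfl | rfl⟩
    · rw [h1, sub_self]; rfl
    · rw [h2, sub_self]; rfl
    · rw [h3]; rfl

theorem image_relations (φ : T →ₐ[k] T') (x : m × n × n → T) :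
    φ '' relations ρ e s x = relations ρ e s (φ ∘ x) := by
  have h1 (l l' : Λ) (i j : n) :
      φ ((pointMap ρ e x (l * l') - pointMap ρ e x l * pointMap ρ e x l') i j) =
      (pointMap ρ e (φ ∘ x) (l * l') - pointMap ρ e (φ ∘ x) l * pointMap ρ e (φ ∘ x) l') i j := by
    simp only [← pointMap_map]
    have : ((pointMap ρ e x l) * (pointMap ρ e x l')).map φ =
      (pointMap ρ e x l).map φ * (pointMap ρ e x l').map φ := Matrix.map_mul (f := (φ : T →+* T'))
    rw [← this]
    simp only [Matrix.sub_apply, map_sub, Matrix.map_apply]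
  have h2 (i j : n) : φ ((pointMap ρ e x 1 - 1) i j) = (pointMap ρ e (φ ∘ x) 1 - 1) i j := by
    simp only [← pointMap_map]
    simp [Matrix.one_apply, apply_ite φ]
  have h3 (i j : n) : φ (extendScalars T s (fun a => Matrix.of fun i j => x (a, i, j)) i j) =
      extendScalars T' s (fun a => Matrix.of fun i j => (φ ∘ x) (a, i, j)) i j :=
    congrFun (congrFun (extendScalars_map s φ (fun a => Matrix.of fun i j => x (a, i, j))) i).symm j
  ext r
  constructor
  · rintro ⟨r, ⟨i, j, ⟨l, l', rfl⟩ | rfl | rfl⟩, rfl⟩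
    · exact ⟨i, j, .inl ⟨l, l', h1 l l' i j⟩⟩
    · exact ⟨i, j, .inr (.inl (h2 i j))⟩
    · exact ⟨i, j, .inr (.inr (h3 i j))⟩
  · rintro ⟨i, j, ⟨l, l', rfl⟩ | rfl | rfl⟩
    · exact ⟨_, ⟨i, j, .inl ⟨l, l', rfl⟩⟩, h1 l l' i j⟩
    · exact ⟨_, ⟨i, j, .inr (.inl rfl)⟩, h2 i j⟩
    · exact ⟨_, ⟨i, j, .inr (.inr rfl)⟩, h3 i j⟩

variable (ρ e s) in
/-- The functor of lifts of `ρ` in the slice is represented by a quotient of a power series ring,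
the one by the ideal of the relations satisfied by the matrix entries of such lifts. -/
theorem exists_universal_slice : ∃ (R : CHat k) (σ : Λ →ₐ[k] Matrix n n R),
    (∀ l, (σ l).map R.residue = ρ l) ∧
    extendScalars R s (fun a => σ (e a) - (ρ (e a)).map (algebraMap k R)) = 0 ∧
    (∀ (S : CHat k) (τ : Λ →ₐ[k] Matrix n n S), (∀ l, (τ l).map S.residue = ρ l) →
      extendScalars S s (fun a => τ (e a) - (ρ (e a)).map (algebraMap k S)) = 0 →
      ∃ ψ : R ⟶ S, ∀ l, (σ l).map ψ.toAlgHom = τ l) ∧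
    ∀ (S : CHat k) (ψ ψ' : R ⟶ S), (∀ l, (σ l).map ψ.toAlgHom = (σ l).map ψ'.toAlgHom) →
      ψ = ψ' := by
  let P : CHat k := CHat.powerSeries k (m × n × n)
  let X : m × n × n → P := MvPowerSeries.X
  have hPX : maximalIdeal P = Ideal.span (Set.range X) := CHat.maximalIdeal_mvPowerSeries
  have hX (i) : X i ∈ maximalIdeal P := hPX.ge (Ideal.subset_span ⟨i, rfl⟩)
  let I : Ideal P := Ideal.span (relations ρ e s X)
  have key (A : Type u) [CommRing A] [Algebra k A] (φ : P →ₐ[k] A)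
      (h : ∀ r ∈ relations ρ e s (φ ∘ X), r = 0) : ∀ r ∈ I, φ r = 0 := by
    have : I ≤ RingHom.ker (φ : P →+* A) := by
      rw [Ideal.span_le]
      intro r hr
      exact h _ ((image_relations φ X).subset ⟨r, hr, rfl⟩)
    exact this
  have hI : I ≤ maximalIdeal P := by
    intro r hr
    rw [← CHat.residue_eq_zero_iff]
    refine key k P.residue ?_ r hr
    have h0 : P.residue ∘ X = 0 := funext fun i => (CHat.residue_eq_zero_iff P _).2 (hX i)
    have h1 (l : Λ) : pointMap ρ e (0 : m × n × n → k) l = ρ l := by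
      ext i j
      simp [pointMap, Matrix.sum_apply]
    rw [h0, relations_eq_zero_iff]
    refine ⟨fun l l' => by simp [h1], by simp [h1], ?_⟩
    exact map_zero (extendScalars k s)
  let R : CHat k := P.quotient I hI
  let π : P →ₐ[k] R := Ideal.Quotient.mkₐ k I
  have hπ : Function.Surjective π := Ideal.Quotient.mk_surjective
  have hR : ∀ r ∈ relations ρ e s (π ∘ X), r = 0 := by
    intro r hr
    rw [← image_relations] at hr
    obtain ⟨r, hr, rfl⟩ := hr
    exact Ideal.Quotient.eq_zero_iff_mem.2 (Ideal.subset_span hr)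
  obtain ⟨h1, h2, h3⟩ := relations_eq_zero_iff.1 hR
  let σ : Λ →ₐ[k] Matrix n n R := AlgHom.ofLinearMap (pointMap ρ e (π ∘ X)) h2 h1
  have hσ (l : Λ) : σ l = pointMap ρ e (π ∘ X) l := rfl
  have hσe (a : m) : σ (e a) - (ρ (e a)).map (algebraMap k R) =
      Matrix.of fun i j => π (X (a, i, j)) := by
    rw [hσ, pointMap_basis, add_sub_cancel_left]
    rfl
  have hRm : maximalIdeal R = Ideal.span (Set.range (π ∘ X)) := by
    rw [← map_maximalIdeal_of_surjective (π : P →+* R) hπ, hPX, Ideal.map_span, ← Set.range_comp]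
    rfl
  refine ⟨R, σ, fun l => ?_, ?_, fun S τ hτ hτs => ?_, fun S ψ ψ' h => ?_⟩
  · rw [hσ, pointMap_map]
    have h0 : R.residue ∘ π ∘ X = 0 := funext fun i => (CHat.residue_eq_zero_iff R _).2
      (hRm.ge (Ideal.subset_span ⟨i, rfl⟩))
    rw [h0]
    ext i j
    simp [pointMap, Matrix.sum_apply]
  · simp only [hσe]
    exact h3
  · let x : m × n × n → S := fun i => (τ (e i.1) - (ρ (e i.1)).map (algebraMap k S)) i.2.1 i.2.2
    have hx (i) : x i ∈ maximalIdeal S :=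
      sub_map_mem_matricesIn S.residue S.residue_eq_zero_iff (hτ (e i.1)) i.2.1 i.2.2
    obtain ⟨φ, hφ⟩ : ∃ φ : P →ₐ[k] S, ∀ i, φ (X i) = x i := CHat.exists_hom_powerSeries hx
    have hφX : φ ∘ X = x := funext hφ
    have hφ0 : ∀ r ∈ I, φ r = 0 := by
      refine key S φ ?_
      rw [hφX, relations_eq_zero_iff]
      refine ⟨fun l l' => ?_, ?_, ?_⟩
      · simp only [x, pointMap_entries, map_mul]
      · simp only [x, pointMap_entries, map_one]
      · exact hτs
    let ψ : R →ₐ[k] S := Ideal.Quotient.liftₐ I φ hφ0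
    refine ⟨CHat.homOfAlgHom ψ, fun l => ?_⟩
    rw [hσ]
    change (pointMap ρ e (π ∘ X) l).map ψ = τ l
    rw [pointMap_map]
    have : ψ ∘ π ∘ X = x := hφX
    rw [this]
    exact pointMap_entries τ l
  · refine CHat.hom_ext_of_span _ hRm fun i => ?_
    have h4 := hσe i.1
    have h5 := congrFun (congrFun (h (e i.1)) i.2.1) i.2.2
    have h6 := congrFun (congrFun h4 i.2.1) i.2.2
    simp only [Matrix.map_apply, Matrix.sub_apply, Matrix.of_apply] at h5 h6
    change ψ.toAlgHom (π (X (i.1, i.2.1, i.2.2))) = ψ'.toAlgHom (π (X (i.1, i.2.1, i.2.2)))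
    rw [← h6, map_sub, map_sub, h5, AlgHom.commutes, AlgHom.commutes]

end UniversalSlice

/-! ### Lifts as matrix representations -/

section Frames

open IsLocalRing

variable {k Λ V : Type u} [Field k] [Ring Λ] [Algebra k Λ] [AddCommGroup V] [Module Λ V]

theorem one_tmul_algebraMap_smul {R : Type u} [CommRing R] [Algebra k R] {M : Type u}
    [AddCommGroup M] [Module R M] [Module (R ⊗[k] Λ) M] [IsScalarTower R (R ⊗[k] Λ) M] (c : k)
    (m : M) : (1 ⊗ₜ[k] algebraMap k Λ c : R ⊗[k] Λ) • m = algebraMap k R c • m := by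
  rw [Algebra.algebraMap_eq_smul_one, ← TensorProduct.smul_tmul, ← algebraMap_smul R c (1 : R),
    ← TensorProduct.smul_tmul', smul_assoc, ← Algebra.TensorProduct.one_def, one_smul]

theorem BaseChange.tmul_sum {R S : Type u} [CommRing R] [Algebra k R] [CommRing S] [Algebra k S]
    {α : R →ₐ[k] S} {M : Type u} [AddCommGroup M] [Module R M] {ι : Type*} (s : S)
    (t : Finset ι) (f : ι → M) :
    BaseChange.tmul α s (∑ i ∈ t, f i) = ∑ i ∈ t, BaseChange.tmul α s (f i) :=
  letI := α.toRingHom.toAlgebra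
  TensorProduct.tmul_sum s t f

variable {R S : CHat k}

theorem isUnit_iff_residue (r : R) : IsUnit r ↔ R.residue r ≠ 0 := by
  rw [ne_eq, CHat.residue_eq_zero_iff, mem_maximalIdeal, mem_nonunits_iff, not_not]

theorem isUnit_det_of_map_residue {n : Type*} [Fintype n] [DecidableEq n] {g : Matrix n n R}
    (hg : g.map R.residue = 1) : IsUnit g.det := by
  rw [isUnit_iff_residue, AlgHom.map_det]
  change Matrix.det (g.map R.residue) ≠ 0
  rw [hg, Matrix.det_one]
  exact one_ne_zero

namespace Lift

theorem φTmul_one_smul_one_tmul (L : Lift Λ V R) (c : k) (l : Λ) (m : L.M) :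
    L.φTmul c ((1 ⊗ₜ[k] l : R ⊗[k] Λ) • m) = l • L.φTmul c m := by
  refine Eq.trans (congrArg L.φ ?_) (map_smul L.φ l _)
  refine Eq.trans ?_ (BaseChange.tmul_smul_tmul R.residue (1 : k) c l m).symm
  rw [one_mul]

section Intertwiners

variable {n : Type*} [Fintype n] [DecidableEq n]

theorem lsmul_eq_toLin {L : Lift Λ V R} {σ : Λ →ₐ[k] Matrix n n R} {x : Module.Basis n R L.M}
    (hx : ∀ l j, (1 ⊗ₜ[k] l : R ⊗[k] Λ) • x j = ∑ i, σ l i j • x i) (l : Λ) :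
    Algebra.lsmul R R L.M (1 ⊗ₜ[k] l : R ⊗[k] Λ) = Matrix.toLin x x (σ l) :=
  x.ext fun j => (hx l j).trans (Matrix.toLin_self _ _ _ _).symm

/-- An invertible intertwiner of matrix representations is the matrix of an isomorphism. -/
theorem exists_linearEquiv_of_intertwiner {L L' : Lift Λ V R} {σ τ : Λ →ₐ[k] Matrix n n R}
    {x : Module.Basis n R L.M} (hx : ∀ l j, (1 ⊗ₜ[k] l : R ⊗[k] Λ) • x j = ∑ i, σ l i j • x i)
    {y : Module.Basis n R L'.M} (hy : ∀ l j, (1 ⊗ₜ[k] l : R ⊗[k] Λ) • y j = ∑ i, τ l i j • y i)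
    {g : Matrix n n R} (hg : IsUnit g.det) (hgσ : ∀ l, g * σ l = τ l * g) :
    ∃ f : L.M ≃ₗ[R ⊗[k] Λ] L'.M, ∀ j, f (x j) = ∑ i, g i j • y i := by
  have hbij : Function.Bijective (Matrix.toLin x y g) := by
    refine Function.bijective_iff_has_inverse.2 ⟨Matrix.toLin y x g⁻¹, fun m => ?_, fun m => ?_⟩
    · rw [← LinearMap.comp_apply, ← Matrix.toLin_mul, Matrix.nonsing_inv_mul _ hg,
        Matrix.toLin_one, LinearMap.id_apply]
    · rw [← LinearMap.comp_apply, ← Matrix.toLin_mul, Matrix.mul_nonsing_inv _ hg,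
        Matrix.toLin_one, LinearMap.id_apply]
  refine ⟨LinearEquiv.ofBijective (BaseChange.mkLinear (Matrix.toLin x y g) fun l m => ?_) hbij,
    fun j => Matrix.toLin_self _ _ _ _⟩
  have h := congrArg (Matrix.toLin x y) (hgσ l)
  rw [Matrix.toLin_mul x x y, Matrix.toLin_mul x y y, ← lsmul_eq_toLin hx,
    ← lsmul_eq_toLin hy] at h
  exact LinearMap.congr_fun h m

/-- The matrix of an isomorphism is an invertible intertwiner of matrix representations. -/
theorem exists_intertwiner_of_linearEquiv {L L' : Lift Λ V R} {σ τ : Λ →ₐ[k] Matrix n n R}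
    {x : Module.Basis n R L.M} (hx : ∀ l j, (1 ⊗ₜ[k] l : R ⊗[k] Λ) • x j = ∑ i, σ l i j • x i)
    {y : Module.Basis n R L'.M} (hy : ∀ l j, (1 ⊗ₜ[k] l : R ⊗[k] Λ) • y j = ∑ i, τ l i j • y i)
    (f : L.M ≃ₗ[R ⊗[k] Λ] L'.M) :
    ∃ g : Matrix n n R, IsUnit g.det ∧ (∀ l, g * σ l = τ l * g) ∧
      ∀ j, f (x j) = ∑ i, g i j • y i := by
  let F : L.M ≃ₗ[R] L'.M := f.restrictScalars R
  refine ⟨LinearMap.toMatrix x y F, F.isUnit_det x y, fun l => ?_, fun j => ?_⟩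
  · apply (Matrix.toLin x y).injective
    rw [Matrix.toLin_mul x x y, Matrix.toLin_mul x y y, ← lsmul_eq_toLin hx, ← lsmul_eq_toLin hy,
      Matrix.toLin_toMatrix]
    ext m
    exact map_smul f _ m
  · rw [← Matrix.toLin_self x y, Matrix.toLin_toMatrix]
    rfl

end Intertwiners

variable [Module k V] [IsScalarTower k Λ V]

theorem φTmul_eq_smul (L : Lift Λ V R) (c : k) (m : L.M) : L.φTmul c m = c • L.φTmul 1 m := by
  rw [← algebraMap_smul Λ c, ← φTmul_one_smul_one_tmul, one_tmul_algebraMap_smul, φTmul_smul,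
    AlgHom.commutes]
  simp

/-- The reduction `M → k ⊗_R M ≅ V`. -/
noncomputable def reduce (L : Lift Λ V R) : L.M →ₛₗ[R.residue.toRingHom] V where
  toFun := L.φTmul 1
  map_add' := L.φTmul_add 1
  map_smul' r m := by
    rw [φTmul_smul, φTmul_eq_smul, mul_one]
    rfl

theorem reduce_one_tmul_smul (L : Lift Λ V R) (l : Λ) (m : L.M) :
    L.reduce ((1 ⊗ₜ[k] l : R ⊗[k] Λ) • m) = l • L.reduce m :=
  L.φTmul_one_smul_one_tmul 1 l m

theorem reduce_smul (L : Lift Λ V R) (r : R) (m : L.M) :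
    L.reduce (r • m) = R.residue r • L.reduce m :=
  map_smulₛₗ L.reduce r m

theorem iso_iff_reduce {L L' : Lift Λ V R} :
    L.Iso L' ↔ ∃ f : L.M ≃ₗ[R ⊗[k] Λ] L'.M, ∀ m, L'.reduce (f m) = L.reduce m := by
  rw [iso_iff]
  refine exists_congr fun f => ⟨fun h => h 1, fun h c m => ?_⟩
  rw [φTmul_eq_smul, φTmul_eq_smul L]
  exact congrArg (c • ·) (h m)

/-- The lift `L` is given, in an `R`-basis lifting the basis `b` of `V`, by the matrix
representation `σ`. -/
def Represents {n : Type*} [Fintype n] [DecidableEq n] (b : Module.Basis n k V) (L : Lift Λ V R)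
    (σ : Λ →ₐ[k] Matrix n n R) : Prop :=
  ∃ x : Module.Basis n R L.M, (∀ i, L.reduce (x i) = b i) ∧
    ∀ l j, (1 ⊗ₜ[k] l : R ⊗[k] Λ) • x j = ∑ i, σ l i j • x i

section

variable {n : Type*} [Fintype n] [DecidableEq n] {b : Module.Basis n k V}

theorem Represents.map_residue {L : Lift Λ V R} {σ : Λ →ₐ[k] Matrix n n R}
    (h : L.Represents b σ) (l : Λ) : (σ l).map R.residue = matrixRep b l := by
  obtain ⟨x, hx, hxσ⟩ := h
  ext i j
  have h1 : l • b j = ∑ i, R.residue (σ l i j) • b i := by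
    rw [← hx, ← reduce_one_tmul_smul, hxσ, map_sum]
    exact Finset.sum_congr rfl fun i _ => by rw [reduce_smul, hx]
  rw [matrixRep_apply, LinearMap.toMatrix_apply]
  change R.residue (σ l i j) = b.repr (l • b j) i
  rw [h1]
  simp [Finsupp.single_apply]

theorem Represents.baseChange {L : Lift Λ V R} {σ : Λ →ₐ[k] Matrix n n R}
    (h : L.Represents b σ) (α : R ⟶ S) :
    (L.baseChange α).Represents b (α.toAlgHom.mapMatrix.comp σ) := by
  obtain ⟨x, hx, hxσ⟩ := h
  let y : Module.Basis n S (BaseChange α.toAlgHom L.M) :=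
    letI := α.toAlgHom.toRingHom.toAlgebra
    x.baseChange S
  have hy (i : n) : y i = BaseChange.tmul α.toAlgHom 1 (x i) :=
    letI := α.toAlgHom.toRingHom.toAlgebra
    x.baseChange_apply S i
  refine ⟨y, fun i => ?_, fun l j => ?_⟩
  · rw [hy]
    refine (baseChange_φTmul α L 1 1 (x i)).trans ?_
    rw [map_one, mul_one]
    exact hx i
  · simp only [hy]
    rw [BaseChange.tmul_smul_tmul, hxσ, mul_one]
    rw [BaseChange.tmul_sum]
    refine Finset.sum_congr rfl fun i _ => ?_
    rw [BaseChange.tmul_smul, BaseChange.smul_tmul]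
    rfl

theorem Represents.iso_iff {L L' : Lift Λ V R} {σ τ : Λ →ₐ[k] Matrix n n R}
    (h : L.Represents b σ) (h' : L'.Represents b τ) :
    L.Iso L' ↔ ∃ g : Matrix n n R, g.map R.residue = 1 ∧ ∀ l, g * σ l = τ l * g := by
  obtain ⟨x, hx, hxσ⟩ := h
  obtain ⟨y, hy, hyτ⟩ := h'
  rw [iso_iff_reduce]
  have hred {f : L.M ≃ₗ[R ⊗[k] Λ] L'.M} {g : Matrix n n R} (hf : ∀ j, f (x j) = ∑ i, g i j • y i)
      (j : n) : L'.reduce (f (x j)) = ∑ i, g.map R.residue i j • b i := by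
    rw [hf, map_sum]
    exact Finset.sum_congr rfl fun i _ => by rw [reduce_smul, hy]; rfl
  constructor
  · rintro ⟨f, hf⟩
    obtain ⟨g, -, hgσ, hg⟩ := exists_intertwiner_of_linearEquiv hxσ hyτ f
    refine ⟨g, ?_, hgσ⟩
    ext i j
    have h1 := hred hg j
    rw [hf, hx] at h1
    have h2 := congrArg (fun v => b.repr v i) h1
    simp only [Module.Basis.repr_self, map_sum, map_smul, Finsupp.smul_single] at h2
    simpa [Finsupp.single_apply, Matrix.one_apply, eq_comm] using h2.symm
  · rintro ⟨g, hg, hgσ⟩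
    obtain ⟨f, hf⟩ := exists_linearEquiv_of_intertwiner hxσ hyτ (isUnit_det_of_map_residue hg) hgσ
    refine ⟨f, fun m => ?_⟩
    rw [← x.sum_repr m]
    simp only [map_sum]
    refine Finset.sum_congr rfl fun j _ => ?_
    rw [show f (x.repr m j • x j) = x.repr m j • f (x j) from map_smul (f.restrictScalars R) _ _,
      reduce_smul, reduce_smul, hred hf, hg, hx]
    simp [Matrix.one_apply]

/-- If the commutant of `V` lifts to the commutant of `L`, then weakly isomorphic lifts are
isomorphic: the automorphism of `V` induced by an isomorphism of the underlying modules lifts to an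
automorphism of `L`, with which the isomorphism is corrected. -/
theorem Represents.iso_of_weakIso {L L' : Lift Λ V R} {σ τ : Λ →ₐ[k] Matrix n n R}
    (h : L.Represents b σ) (h' : L'.Represents b τ)
    (hcomm : ∀ a : Matrix n n k, (∀ l : Λ, matrixRep b l * a = a * matrixRep b l) →
      ∃ A : Matrix n n R, A.map R.residue = a ∧ ∀ l, σ l * A = A * σ l)
    (hw : L.WeakIso L') : L.Iso L' := by
  rw [h.iso_iff h']
  have hσ := h.map_residue
  have hτ := h'.map_residue
  obtain ⟨x, hx, hxσ⟩ := h
  obtain ⟨y, hy, hyτ⟩ := h'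
  obtain ⟨g, hg, hgσ, -⟩ := exists_intertwiner_of_linearEquiv hxσ hyτ hw.some
  have hmul (x y : Matrix n n R) : (x * y).map R.residue = x.map R.residue * y.map R.residue :=
    map_mul R.residue.mapMatrix x y
  have hres (l : Λ) : matrixRep b l * g.map R.residue = g.map R.residue * matrixRep b l := by
    have := congrArg (fun M : Matrix n n R => M.map R.residue) (hgσ l)
    simp only [hmul, hσ, hτ] at this
    exact this.symm
  obtain ⟨A, hA, hAσ⟩ := hcomm _ hres
  have hAdet : IsUnit A.det := by
    rw [isUnit_iff_residue, AlgHom.map_det]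
    change Matrix.det (A.map R.residue) ≠ 0
    rw [hA]
    exact ((AlgHom.map_det R.residue g).symm ▸ hg.map R.residue).ne_zero
  refine ⟨g * A⁻¹, ?_, fun l => ?_⟩
  · have h1 : A.map R.residue * A⁻¹.map R.residue = 1 := by
      rw [← hmul, Matrix.mul_nonsing_inv _ hAdet]
      exact map_one R.residue.mapMatrix
    rw [hmul, ← hA, h1]
  · have h1 : A⁻¹ * σ l = σ l * A⁻¹ := by
      have h2 : A⁻¹ * (σ l * A) * A⁻¹ = A⁻¹ * (A * σ l) * A⁻¹ := by rw [hAσ]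
      rw [← mul_assoc, mul_assoc _ A, Matrix.mul_nonsing_inv _ hAdet, ← mul_assoc,
        Matrix.nonsing_inv_mul _ hAdet, mul_one, one_mul] at h2
      exact h2
    rw [mul_assoc, h1, ← mul_assoc, hgσ, mul_assoc]

end

/-- Every lift is represented by a matrix representation. -/
theorem exists_represents {n : Type*} [Fintype n] [DecidableEq n] (b : Module.Basis n k V)
    [Module.Finite k Λ] (L : Lift Λ V R) :
    ∃ σ : Λ →ₐ[k] Matrix n n R, L.Represents b σ := by
  have : Module.Finite R L.M := Module.Finite.trans (R ⊗[k] Λ) L.M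
  let e := Module.Free.chooseBasis R L.M
  -- a basis of the free `R`-module reduces to a basis of `V`
  have hli : LinearIndependent k (fun i => L.reduce (e i)) := by
    rw [Fintype.linearIndependent_iff]
    intro c hc i
    let t : k → L.M → BaseChange R.residue L.M := BaseChange.tmul R.residue
    let T : BaseChange R.residue L.M := ∑ i, t (c i) (e i)
    have h0 : T = 0 := by
      have h1 : L.φ (T : Reduction R L.M) = 0 := by
        refine (map_sum L.φ (fun i => (t (c i) (e i) : Reduction R L.M)) _).trans ?_
        refine (Finset.sum_congr rfl fun i _ => ?_).trans hc
        exact L.φTmul_eq_smul (c i) (e i)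
      exact (map_eq_zero_iff L.φ L.φ.injective).1 h1
    let coord : L.M →ₛₗ[R.residue.toRingHom] k :=
      { toFun := fun m => R.residue (e.repr m i)
        map_add' := by simp
        map_smul' := by simp }
    have h1 := congrArg (BaseChange.lift coord) h0
    simp only [T, t, map_sum, BaseChange.lift_tmul, map_zero] at h1
    have h2 (j) : coord (e j) = if j = i then 1 else 0 := by
      change R.residue (e.repr (e j) i) = _
      simp [Finsupp.single_apply, apply_ite R.residue]
    have h3 : ∑ j, c j * coord (e j) = 0 := h1
    rw [Finset.sum_congr rfl fun j _ => by rw [h2 j]] at h3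
    simpa using h3
  have hspan : ⊤ ≤ Submodule.span k (Set.range fun i => L.reduce (e i)) := by
    rintro v -
    obtain ⟨x, rfl⟩ := L.φ.surjective v
    induction x using BaseChange.induction with
    | add x y hx hy =>
      have := add_mem hx hy
      rwa [← show L.φ (x + y) = L.φ x + L.φ y from map_add L.φ x y] at this
    | tmul c m =>
      change L.φTmul c m ∈ _
      rw [φTmul_eq_smul]
      refine Submodule.smul_mem _ _ ?_
      change L.reduce m ∈ _
      rw [← e.sum_repr m, map_sum]
      refine sum_mem fun i _ => ?_
      rw [reduce_smul]
      exact Submodule.smul_mem _ _ (Submodule.subset_span ⟨i, rfl⟩)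
  let c := Module.Basis.mk hli hspan
  -- both `c` and `b` are bases of `V`, which identifies the index sets
  let ε := c.indexEquiv b
  let e' := e.reindex ε
  let c' := c.reindex ε
  have hc (i : n) : L.reduce (e' i) = c' i := by simp [e', c', c]
  -- the change of basis from `c'` to `b` lifts to `R`
  let G : Matrix n n R := (c'.toMatrix b).map (algebraMap k R)
  have hG : IsUnit G.det := by
    have h1 : IsUnit (c'.toMatrix b).det := c'.isUnit_det b
    have := h1.map (algebraMap k R)
    rwa [RingHom.map_det] at this
  let E : L.M ≃ₗ[R] L.M := Matrix.toLinearEquiv e' G hG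
  have hE (j : n) : E (e' j) = ∑ i, G i j • e' i := Matrix.toLin_self _ _ _ _
  let x := e'.map E
  let σ : R ⊗[k] Λ →ₐ[R] Matrix n n R :=
    (LinearMap.toMatrixAlgEquiv x).toAlgHom.comp (Algebra.lsmul R R L.M)
  refine ⟨(σ.restrictScalars k).comp Algebra.TensorProduct.includeRight, x, fun j => ?_,
    fun l j => ?_⟩
  · rw [Module.Basis.map_apply, hE, map_sum]
    rw [← c'.sum_toMatrix_smul_self b]
    refine Finset.sum_congr rfl fun i _ => ?_
    rw [reduce_smul, hc]
    simp [G]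
  · change Algebra.lsmul R R L.M (1 ⊗ₜ[k] l : R ⊗[k] Λ) (x j) =
      ∑ i, LinearMap.toMatrix x x (Algebra.lsmul R R L.M (1 ⊗ₜ[k] l : R ⊗[k] Λ)) i j • x i
    rw [← Matrix.toLin_self x x, Matrix.toLin_toMatrix]

/-- Every matrix representation lifting the one on `V` represents a lift of `V`, with underlying
module `n → R`. Here `n : Type`, so that this module lives in the universe of `R`. -/
theorem exists_lift_represents {n : Type} [Fintype n] [DecidableEq n] (b : Module.Basis n k V)
    (σ : Λ →ₐ[k] Matrix n n R) (hσ : ∀ l, (σ l).map R.residue = matrixRep b l) :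
    ∃ L : Lift Λ V R, L.Represents b σ := by
  have hcomm (r : R) (l : Λ) : Commute (Algebra.ofId R (Matrix n n R) r) (σ l) :=
    Algebra.commutes r _
  let B : R ⊗[k] Λ →ₐ[R] Matrix n n R :=
    Algebra.TensorProduct.lift (Algebra.ofId R (Matrix n n R)) σ hcomm
  have hB (l : Λ) : B (1 ⊗ₜ[k] l) = σ l := by
    rw [Algebra.TensorProduct.lift_tmul, map_one, one_mul]
  let A : R ⊗[k] Λ →ₐ[R] Module.End R (n → R) := Matrix.toLinAlgEquiv'.toAlgHom.comp B
  have hA (l : Λ) (m : n → R) : A (1 ⊗ₜ[k] l) m = (σ l).mulVec m := by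
    rw [← hB]
    rfl
  let _ : Module (R ⊗[k] Λ) (n → R) := Module.compHom _ A.toRingHom
  have _ : IsScalarTower R (R ⊗[k] Λ) (n → R) := ⟨fun r a m => by
    change A (r • a) m = r • A a m
    rw [map_smul]
    rfl⟩
  have hsmul (l : Λ) (m : n → R) : (1 ⊗ₜ[k] l : R ⊗[k] Λ) • m = (σ l).mulVec m := hA l m
  have : Module.Finite (R ⊗[k] Λ) (n → R) := Module.Finite.of_restrictScalars_finite R _ _
  let F : (n → R) →ₛₗ[R.residue.toRingHom] V :=
    { toFun := fun m => ∑ i, R.residue (m i) • b i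
      map_add' := by simp [add_smul, Finset.sum_add_distrib]
      map_smul' := by simp [mul_smul, Finset.smul_sum] }
  have hF (m : n → R) : F m = b.equivFun.symm (R.residue ∘ m) := by
    rw [Module.Basis.equivFun_symm_apply]
    rfl
  have hFb (i : n) : F (Pi.single i 1) = b i := by
    rw [hF, LinearEquiv.symm_apply_eq]
    ext j
    simp [Pi.single_apply, apply_ite R.residue, eq_comm]
  let Φ : BaseChange R.residue (n → R) →ₗ[k] V := BaseChange.lift F
  have hΦ (c : k) (m : n → R) : Φ (BaseChange.tmul R.residue c m) = c • F m := rfl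
  let Ψ : V →ₗ[k] BaseChange R.residue (n → R) :=
    b.constr k fun i => BaseChange.tmul R.residue 1 (Pi.single i 1)
  have hΨ (i : n) : Ψ (b i) = BaseChange.tmul R.residue 1 (Pi.single i 1) := b.constr_basis k _ i
  have hbij : Function.Bijective Φ := by
    refine Function.bijective_iff_has_inverse.2 ⟨Ψ, fun x => ?_, fun v => ?_⟩
    · refine LinearMap.congr_fun (f := Ψ ∘ₗ Φ) (g := LinearMap.id)
        (BaseChange.end_ext _ _ fun m => ?_) x
      rw [LinearMap.comp_apply, hΦ, one_smul, LinearMap.id_apply]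
      change Ψ (∑ i, R.residue (m i) • b i) = _
      conv_rhs => rw [pi_eq_sum_univ' m, BaseChange.tmul_sum]
      rw [map_sum]
      refine Finset.sum_congr rfl fun i _ => ?_
      rw [map_smul, hΨ, BaseChange.tmul_smul, BaseChange.smul_tmul]
    · refine LinearMap.congr_fun (f := Φ ∘ₗ Ψ) (g := LinearMap.id) (b.ext fun i => ?_) v
      rw [LinearMap.comp_apply, hΨ, hΦ, hFb, one_smul, LinearMap.id_apply]
  have hFl (l : Λ) (m : n → R) : F ((σ l).mulVec m) = l • F m := by
    rw [hF, LinearEquiv.symm_apply_eq]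
    have h1 := matrixRep_mulVec_repr b l (F m)
    rw [← hσ] at h1
    refine Eq.trans ?_ h1
    have h2 : ⇑(b.repr (F m)) = R.residue ∘ m := by
      rw [← Module.Basis.equivFun_apply, hF, LinearEquiv.apply_symm_apply]
    rw [h2]
    ext i
    simp [Matrix.mulVec, dotProduct]
  have hΦl (l : Λ) (x : BaseChange R.residue (n → R)) :
      Φ ((1 ⊗ₜ[k] l : k ⊗[k] Λ) • x) = l • Φ x := by
    induction x using BaseChange.induction with
    | add x y hx hy => rw [smul_add, map_add, map_add, smul_add, hx, hy]
    | tmul c m => rw [BaseChange.tmul_smul_tmul, hΦ, hΦ, hsmul, hFl, one_mul, smul_comm]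
  let φ : Reduction R (n → R) →ₗ[Λ] V :=
    { toFun := Φ
      map_add' := map_add Φ
      map_smul' := hΦl }
  refine ⟨{ M := n → R, φ := LinearEquiv.ofBijective φ hbij }, Pi.basisFun R n,
    fun i => ?_, fun l j => ?_⟩
  · rw [Pi.basisFun_apply]
    exact (one_smul k _).trans (hFb i)
  · rw [Pi.basisFun_apply]
    refine (hsmul l _).trans ?_
    ext i
    simp [Pi.single_apply]

end Lift

end Frames

/-! ### Versal deformation rings -/

section Versal

open IsLocalRing

variable {k : Type u} [Field k]

namespace CHat

/-- The morphisms to the dual numbers separate the cotangent space `m / m ^ 2`. -/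
theorem exists_hom_dualNumber_ne {R : CHat k} {t t' : R} (ht : t ∈ maximalIdeal R)
    (ht' : t' ∈ maximalIdeal R) (h : t - t' ∉ maximalIdeal R ^ 2) :
    ∃ f : R ⟶ dualNumber k, f.toAlgHom t ≠ f.toAlgHom t' := by
  obtain ⟨μ, hμ, hμ2⟩ := Submodule.exists_le_ker_of_notMem
    (p := (maximalIdeal R ^ 2).restrictScalars k) (v := t - t')
    fun h' => h ((Submodule.restrictScalars_mem k _ _).1 h')
  have hμ0 {r s : R} (hr : r ∈ maximalIdeal R) (hs : s ∈ maximalIdeal R) : μ (r * s) = 0 :=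
    hμ2 (by
      rw [Submodule.restrictScalars_mem, pow_two]
      exact Ideal.mul_mem_mul hr hs)
  let d : R → k := fun r => μ (r - algebraMap k R (R.residue r))
  have hd {r : R} (hr : r ∈ maximalIdeal R) : d r = μ r := by
    simp [d, (R.residue_eq_zero_iff r).2 hr]
  let f : R →ₐ[k] DualNumber k :=
    { toFun := fun r => .inl (R.residue r) + .inr (d r)
      map_one' := by ext <;> simp [d]
      map_zero' := by ext <;> simp [d]
      map_add' := fun r s => by
        ext
        · simp
        · simp [d]
          ring
      map_mul' := fun r s => by
        ext
        · simp
        · suffices d (r * s) = R.residue r • d s + R.residue s • d r by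
            simpa [mul_comm (d r)] using this
          have h1 : μ ((r - algebraMap k R (R.residue r)) * (s - algebraMap k R (R.residue s))) =
              0 := hμ0 (by rw [← residue_eq_zero_iff]; simp) (by rw [← residue_eq_zero_iff]; simp)
          rw [← map_smul, ← map_smul, ← map_add, ← sub_eq_zero, ← map_sub, ← h1]
          congr 1
          simp only [Algebra.smul_def, map_mul]
          ring
      commutes' := fun c => by ext <;> simp [d, TrivSqZeroExt.algebraMap_eq_inl] }
  refine ⟨homOfAlgHom f, fun hf => hμ ?_⟩
  have h0 : f t = f t' := hf
  have h1 : d t = d t' := by simpa [f] using congrArg TrivSqZeroExt.snd h0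
  rw [map_sub, ← hd ht, ← hd ht', h1, sub_self]

/-- If an endomorphism `θ` of `R` is invisible to morphisms to the dual numbers, then it is an
epimorphism: it is the identity on `m / m ^ 2`, so `θ(m)` generates `m` by Nakayama's lemma. -/
theorem hom_ext_of_comp_dualNumber {R S : CHat k} (θ : R ⟶ R)
    (hθ : ∀ f : R ⟶ dualNumber k, θ ≫ f = f) {f g : R ⟶ S} (h : θ ≫ f = θ ≫ g) : f = g := by
  refine hom_ext_of_span (fun t : maximalIdeal R => θ.toAlgHom t) (le_antisymm ?_ ?_)
    fun t => congrArg (fun a : R ⟶ S => a.toAlgHom t) h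
  · refine Submodule.le_of_le_smul_of_le_jacobson_bot (I := maximalIdeal R)
      ((isNoetherianRing_iff_ideal_fg R).1 inferInstance _)
      (IsLocalRing.maximalIdeal_le_jacobson _) fun t ht => ?_
    refine Submodule.mem_sup.2 ⟨θ.toAlgHom t, Ideal.subset_span ⟨⟨t, ht⟩, rfl⟩,
      t - θ.toAlgHom t, ?_, by simp⟩
    rw [smul_eq_mul, ← pow_two]
    by_contra h1
    obtain ⟨f, hf⟩ := exists_hom_dualNumber_ne ht (θ.map_mem ht) h1
    exact hf (congrArg (fun a : R ⟶ dualNumber k => a.toAlgHom t) (hθ f)).symm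
  · rw [Ideal.span_le]
    rintro _ ⟨t, rfl⟩
    exact θ.map_mem t.2

end CHat

/-- If there is a universal deformation ring, then every versal one is universal. The composite
`χ ≫ ψ` of the comparison morphisms preserves the versal deformation, hence is invisible to
morphisms to the dual numbers and can be cancelled. -/
theorem HasUniversalDeformationRing.versalDeformationsAreUniversal {Λ V : Type u} [Ring Λ]
    [Algebra k Λ] [AddCommGroup V] [Module Λ V] (h : HasUniversalDeformationRing k Λ V) :
    VersalDeformationsAreUniversal k Λ V := by
  obtain ⟨R₀, u₀, h₀⟩ := h
  rintro R u ⟨hex, huniq⟩ S d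
  have hcomp {A B C : CHat k} (α : A ⟶ B) (β : B ⟶ C) (x) :
      (deformationFunctor k Λ V).map (α ≫ β) x =
        (deformationFunctor k Λ V).map β ((deformationFunctor k Λ V).map α x) := by
    rw [Functor.map_comp]
    rfl
  obtain ⟨f, hf⟩ := hex S d
  refine ⟨f, hf, fun g hg => ?_⟩
  obtain ⟨ψ, hψ, -⟩ := h₀ R u
  obtain ⟨χ, hχ⟩ := hex R₀ u₀
  refine CHat.hom_ext_of_comp_dualNumber (χ ≫ ψ) (fun a => ?_) ?_
  · refine (huniq _).unique (y₁ := (χ ≫ ψ) ≫ a) ?_ rfl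
    rw [hcomp, hcomp, hχ, hψ]
  · rw [Category.assoc, Category.assoc]
    congr 1
    refine (h₀ S d).unique ?_ ?_
    · rw [hcomp, hψ]
      exact hg
    · rw [hcomp, hψ]
      exact hf

end Versal

/-! ### The deformation functor -/

section Universal

variable {k Λ V : Type u} [Field k] [Ring Λ] [Algebra k Λ] [Module.Finite k Λ] [AddCommGroup V]
  [Module k V] [Module Λ V] [IsScalarTower k Λ V] [Module.Finite Λ V]

/-- The map `[M, φ] ↦ [M]` is a natural isomorphism if endomorphisms of `V` are stably scalar and
`Ext¹(V, Λ) = 0`. -/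
theorem exists_iso_weakDeformationFunctor (hExt : ExtOneVanishes Λ V)
    (hEnd : ∀ f : Module.End Λ V, ∃ c : k, FactorsThroughProjective (f - algebraMap k _ c)) :
    ∃ e : deformationFunctor k Λ V ≅ weakDeformationFunctor k Λ V,
      e.hom = toWeakDeformation k Λ V := by
  have : Module.Finite k V := Module.Finite.trans Λ V
  have hiso (R : CHat k) : IsIso ((toWeakDeformation k Λ V).app R) := by
    rw [isIso_iff_bijective]
    refine ⟨fun d d' h => ?_, fun d => ?_⟩
    · induction d using Quotient.inductionOn with | h L =>
      induction d' using Quotient.inductionOn with | h L' =>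
      have hw : L.WeakIso L' := Quotient.exact h
      let b := Module.finBasis k V
      obtain ⟨σ, hσ⟩ := L.exists_represents b
      obtain ⟨τ, hτ⟩ := L'.exists_represents b
      refine Quotient.sound (hσ.iso_of_weakIso hτ (fun a ha => ?_) hw)
      exact exists_commutant_lift hExt hEnd b R.residue (fun r => (R.residue_eq_zero_iff r).1)
        hσ.map_residue a ha
    · induction d using Quotient.inductionOn with | h L =>
      exact ⟨Quotient.mk _ L, rfl⟩
  have := NatIso.isIso_of_isIso_app (toWeakDeformation k Λ V)
  exact ⟨asIso (toWeakDeformation k Λ V), rfl⟩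

/-- The universal lift in the slice is a universal deformation: every lift is conjugate to exactly
one lift in the slice. -/
theorem hasUniversalDeformationRing (hExt : ExtOneVanishes Λ V)
    (hEnd : ∀ f : Module.End Λ V, ∃ c : k, FactorsThroughProjective (f - algebraMap k _ c)) :
    HasUniversalDeformationRing k Λ V := by
  have : Module.Finite k V := Module.Finite.trans Λ V
  let b := Module.finBasis k V
  let e := Module.finBasis k Λ
  obtain ⟨s, hs, hs'⟩ := exists_generalizedInverse (bracket k (matrixRep (Λ := Λ) b) e)
  obtain ⟨R, σ, hσ, hσs, hex, huniq⟩ := exists_universal_slice (matrixRep (Λ := Λ) b) e s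
  obtain ⟨L, hL⟩ := Lift.exists_lift_represents b σ hσ
  refine ⟨R, Quotient.mk _ L, fun S d => ?_⟩
  induction d using Quotient.inductionOn with | h M =>
  have hslice (ψ : R ⟶ S) : extendScalars S s (fun a => (ψ.toAlgHom.mapMatrix.comp σ) (e a) -
      (matrixRep b (e a)).map (algebraMap k S)) = 0 := by
    have h1 := extendScalars_map s ψ.toAlgHom
      (fun a => σ (e a) - (matrixRep b (e a)).map (algebraMap k R))
    rw [hσs] at h1
    refine Eq.trans (congrArg _ (funext fun a => ?_)) (h1.trans (Matrix.map_zero _ (map_zero _)))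
    ext i j
    simp
  have hmk (ψ : R ⟶ S) : (deformationFunctor k Λ V).map ψ (Quotient.mk _ L) = Quotient.mk _ M ↔
      (L.baseChange ψ).Iso M := Quotient.eq (r := Lift.isoSetoid Λ V S)
  obtain ⟨σM, hM⟩ := M.exists_represents b
  obtain ⟨τ, g, hτ, hτs, hg, hgσ⟩ :=
    exists_conj_mem_slice S.residue S.residue_eq_zero_iff hs' hM.map_residue
  obtain ⟨ψ, hψ⟩ := hex S τ hτ hτs
  have hψτ : ψ.toAlgHom.mapMatrix.comp σ = τ := AlgHom.ext hψ
  have hψM : (L.baseChange ψ).Iso M := by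
    refine (Lift.isoSetoid Λ V S).symm ((hM.iso_iff (hL.baseChange ψ)).2 ⟨g, hg, ?_⟩)
    rw [hψτ]
    exact hgσ
  refine ⟨ψ, (hmk ψ).2 hψM, fun χ hχ => huniq S χ ψ fun l => ?_⟩
  have hχψ : (L.baseChange χ).Iso (L.baseChange ψ) :=
    (Lift.isoSetoid Λ V S).trans ((hmk χ).1 hχ) ((Lift.isoSetoid Λ V S).symm hψM)
  have hLχ := hL.baseChange χ
  have hLψ := hL.baseChange ψ
  obtain ⟨g, hg, hgσ⟩ := (hLχ.iso_iff hLψ).1 hχψ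
  have := eq_of_conj_of_mem_slice S.residue e S.residue_eq_zero_iff hs hLχ.map_residue
    hLψ.map_residue (hslice χ) (hslice ψ) (fun a ha => exists_commutant_lift hExt hEnd b S.residue
      (fun r => (S.residue_eq_zero_iff r).1) hLχ.map_residue a ha) g hg hgσ
  exact DFunLike.congr_fun this l

end Universal

end ModuleDeformation

theorem mainTheorem2 {k Λ : Type u} [Field k] [Ring Λ] [Algebra k Λ] [Module.Finite k Λ]
    (V : Type u) [AddCommGroup V] [Module k V] [Module Λ V] [IsScalarTower k Λ V]
    [Module.Finite Λ V] (hV : ModuleDeformation.IsGorensteinProjective Λ V)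
    (hEnd : Nonempty (ModuleDeformation.StableEnd Λ V ≃ₐ[k] k)) :
    (∃ e : ModuleDeformation.deformationFunctor k Λ V ≅
        ModuleDeformation.weakDeformationFunctor k Λ V,
      e.hom = ModuleDeformation.toWeakDeformation k Λ V) ∧
    ModuleDeformation.HasUniversalDeformationRing k Λ V ∧
    ModuleDeformation.VersalDeformationsAreUniversal k Λ V ∧
    ∀ (P : Type u) [AddCommGroup P] [Module k P] [Module Λ P] [IsScalarTower k Λ P]
      (p : P →ₗ[Λ] V), ModuleDeformation.IsProjectiveCover p →
        Nonempty (ModuleDeformation.StableEnd Λ (LinearMap.ker p) ≃ₐ[k] k) ∧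
        ModuleDeformation.HasUniversalDeformationRing k Λ (LinearMap.ker p) ∧
        ModuleDeformation.VersalDeformationsAreUniversal k Λ (LinearMap.ker p) := by
  obtain ⟨hExt, Q, _, _, q, hQ, hq, hExtq⟩ := hV.exists_presentation
  have hscalar := (ModuleDeformation.nonempty_stableEnd_algEquiv_iff.1 hEnd).1
  have huniv := ModuleDeformation.hasUniversalDeformationRing hExt hscalar
  refine ⟨ModuleDeformation.exists_iso_weakDeformationFunctor hExt hscalar, huniv,
    huniv.versalDeformationsAreUniversal, fun P _ _ _ _ p hp => ?_⟩
  have : IsNoetherianRing Λ := IsNoetherianRing.of_finite k Λ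
  have := hp.finite
  have := hp.projective
  have hEndΩ := ModuleDeformation.nonempty_stableEnd_ker_algEquiv hExt hp.surjective hEnd
  have hunivΩ := ModuleDeformation.hasUniversalDeformationRing
    (hExtq.ker_of_ker hp.surjective hq)
    (ModuleDeformation.nonempty_stableEnd_algEquiv_iff.1 hEndΩ).1
  exact ⟨hEndΩ, hunivΩ, hunivΩ.versalDeformationsAreUniversal⟩
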